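/- Let $(S_1,S_2)$ be a bi-isometry on a complex Hilbert space $\mathscr H$, i.e. $S_1S_2=S_2S_1$ and $S_1^*S_1=S_2^*S_2=I$. Assume that $\ker S_1^*$ is one-dimensional. Let $\mathscr H_\infty(S_1)=\bigcap_{n\ge 0}S_1^n\mathscr H$, a closed subspace which $S_1$ maps into itself, and assume that the spectrum $\sigma(S_1|_{\mathscr H_\infty(S_1)})$ has arc-length measure zero (as a subset of the unit circle $\mathbb T$). Write $H^2$ for the Hardy space of the open unit disc $\mathbb D$ (the power series with square-summable coefficients), $M_\varphi$ for multiplication by a bounded holomorphic function $\varphi$ on $H^2$, and $M_z$ for multiplication by the coordinate function. Say that $(U,A,B,\varphi)$ is a model of $(S_1,S_2)$ if $U$ is a unitary operator on $\mathscr H_\infty(S_1)$, $A$ is an isometry on $\mathscr H_\infty(S_1)$, $B:H^2\to\mathscr H_\infty(S_1)$ is a bounded linear operator, $\varphi$ is a holomorphic function on $\mathbb D$ with $|\varphi|\le 1$, one has $$UA=AU,\qquad UB=BM_z,\qquad A^*B=0,\qquad B^*B+M_\varphi^*M_\varphi=I,$$ and the pair $(S_1,S_2)$ is unitarily equivalent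 (by one unitary operator for both entries) to $$\left(\begin{bmatrix}U&0\\0&M_z\end{bmatrix},\ \begin{bmatrix}A&B\\0&M_\varphi\end{bmatrix}\right)\quad\text{on }\ \mathscr H_\infty(S_1)\oplus H^2 .$$ Then: 1. $(S_1,S_2)$ has a model with $U=S_1|_{\mathscr H_\infty(S_1)}$. 2. For every model $(U,A,B,\varphi)$ of $(S_1,S_2)$, the function $\varphi$ is inner (at almost every point of $\mathbb T$ it has a radial limit of modulus one) and $B=0$. 3. $\mathscr H_\infty(S_1)$ reduces $(S_1,S_2)$ to a doubly commuting bi-isometry: $\mathscr H_\infty(S_1)$ and its orthogonal complement are invariant under $S_1$ and $S_2$, and the restrictions $T_i=S_i|_{\mathscr H_\infty(S_1)}$ are commuting isometries with $T_1^*T_2=T_2T_1^*$. -/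

import Mathlib

open scoped InnerProductSpace ENNReal Topology

noncomputable section

/-! ### The Hardy space of the unit disc -/

namespace Hardy

open Complex

/-- The Hilbert space of square-summable complex sequences. -/
abbrev SqSum : Type := lp (fun _ : ℕ => ℂ) 2

theorem summable_coeff_mul_pow (a : SqSum) {z : ℂ} (hz : ‖z‖ < 1) :
    Summable (fun n : ℕ => ‖a n * z ^ n‖) := by
  refine Summable.of_nonneg_of_le (fun _ => norm_nonneg _) (fun n => ?_)
    ((summable_geometric_of_lt_one (norm_nonneg z) hz).mul_left ‖a‖)
  rw [norm_mul, norm_pow]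
  gcongr
  exact lp.norm_apply_le_norm (by norm_num) a n

/-- The function on the open unit disc with Taylor coefficients `a`. -/
def powerSum : SqSum →ₗ[ℂ] (UnitDisc → ℂ) where
  toFun a z := ∑' n : ℕ, a n * (z : ℂ) ^ n
  map_add' a b := by
    funext z
    have ha := (summable_coeff_mul_pow a z.norm_lt_one).of_norm
    have hb := (summable_coeff_mul_pow b z.norm_lt_one).of_norm
    simp only [lp.coeFn_add, Pi.add_apply, add_mul]
    exact ha.tsum_add hb
  map_smul' c a := by
    funext z
    simp only [lp.coeFn_smul, Pi.smul_apply, smul_eq_mul, mul_assoc, RingHom.id_apply]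
    exact tsum_mul_left

theorem hasSum_powerSum (a : SqSum) (z : UnitDisc) :
    HasSum (fun n : ℕ => a n * (z : ℂ) ^ n) (powerSum a z) :=
  (summable_coeff_mul_pow a z.norm_lt_one).of_norm.hasSum

theorem hasFPowerSeriesOnBall_of_hasSum {c : ℕ → ℂ} {g : ℂ → ℂ}
    (h : ∀ z : ℂ, ‖z‖ < 1 → HasSum (fun n => c n * z ^ n) (g z)) :
    HasFPowerSeriesOnBall g (FormalMultilinearSeries.ofScalars ℂ c) 0 1 where
  r_le := by
    refine ENNReal.le_of_forall_nnreal_lt fun r hr => ?_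
    have hr1 : (r : ℝ) < 1 := by exact_mod_cast hr
    apply FormalMultilinearSeries.le_radius_of_tendsto (l := 0)
    have := (h (r : ℝ) (by simpa using hr1)).summable.tendsto_atTop_zero.norm
    simpa [FormalMultilinearSeries.ofScalars_norm] using this
  r_pos := one_pos
  hasSum := by
    intro y hy
    have hy' : ‖y‖ < 1 := by simpa [enorm_eq_nnnorm, ← NNReal.coe_lt_coe] using hy
    simpa [FormalMultilinearSeries.ofScalars_apply_eq, mul_comm] using h y hy'

theorem powerSum_injective : Function.Injective powerSum := by
  intro a b hab
  let g : ℂ → ℂ := fun z => ∑' n : ℕ, a n * z ^ n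
  have ha : ∀ z : ℂ, ‖z‖ < 1 → HasSum (fun n => a n * z ^ n) (g z) := fun z hz =>
    (summable_coeff_mul_pow a hz).of_norm.hasSum
  have hb : ∀ z : ℂ, ‖z‖ < 1 → HasSum (fun n => b n * z ^ n) (g z) := fun z hz => by
    have h1 := hasSum_powerSum b (UnitDisc.mk z hz)
    rw [← hab] at h1
    exact h1
  have h := (hasFPowerSeriesOnBall_of_hasSum ha).hasFPowerSeriesAt.eq_formalMultilinearSeries
    (hasFPowerSeriesOnBall_of_hasSum hb).hasFPowerSeriesAt
  ext n
  exact congrFun (FormalMultilinearSeries.ofScalars_series_injective ℂ ℂ h) n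

/-- The Hardy space `H²` of the open unit disc: the functions on the disc given by a power series
with square-summable coefficients. -/
def H2 : Type := ↥(LinearMap.range powerSum)

instance : AddCommGroup H2 := inferInstanceAs (AddCommGroup ↥(LinearMap.range powerSum))

instance : Module ℂ H2 := inferInstanceAs (Module ℂ ↥(LinearMap.range powerSum))

/-- The elements of the Hardy space are functions on the open unit disc. -/
def H2.toFun (f : H2) : UnitDisc → ℂ := Subtype.val f

instance : CoeFun H2 (fun _ => UnitDisc → ℂ) := ⟨H2.toFun⟩

/-- The sequence of Taylor coefficients at the origin, as a linear bijection onto `ℓ²`. -/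
def coeff : H2 ≃ₗ[ℂ] SqSum := (LinearEquiv.ofInjective powerSum powerSum_injective).symm

/-- The norm of a Hardy space function is the `ℓ²`-norm of its Taylor coefficients. -/
instance : NormedAddCommGroup H2 :=
  NormedAddCommGroup.induced H2 SqSum coeff coeff.injective

theorem H2.norm_eq (f : H2) : ‖f‖ = ‖coeff f‖ := rfl

/-- The inner product of two Hardy space functions is that of their Taylor coefficients. -/
instance : InnerProductSpace ℂ H2 := InnerProductSpace.induced coeff

/-- Taylor coefficients, as a unitary operator from the Hardy space onto `ℓ²`. -/
def coeffIsometry : H2 ≃ₗᵢ[ℂ] SqSum where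
  toLinearEquiv := coeff
  norm_map' _ := rfl

instance : CompleteSpace H2 :=
  coeffIsometry.toIsometryEquiv.completeSpace_iff.mpr inferInstance

theorem H2.ext {f g : H2} (h : ∀ z, f z = g z) : f = g := Subtype.ext (funext h)

theorem H2.hasSum (f : H2) (z : UnitDisc) :
    HasSum (fun n : ℕ => coeff f n * (z : ℂ) ^ n) (f z) := by
  have h := hasSum_powerSum (coeff f) z
  have h2 : powerSum (coeff f) = f.toFun :=
    congrArg Subtype.val ((LinearEquiv.ofInjective powerSum powerSum_injective).apply_symm_apply f)
  rwa [h2] at h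

/-! Multiplication by a bounded holomorphic function preserves the Hardy space. -/

/-- The mean square of an absolutely convergent Fourier series. -/
theorem norm_sq_toLp_tsum_fourier {c : ℕ → ℂ} (hc : Summable fun n => ‖c n‖) :
    HasSum (fun n => ‖c n‖ ^ 2)
      (‖ContinuousMap.toLp (E := ℂ) 2 AddCircle.haarAddCircle ℂ
        (∑' n : ℕ, c n • (fourier (n : ℤ) : C(UnitAddCircle, ℂ)))‖ ^ 2) := by
  set L := ContinuousMap.toLp (E := ℂ) 2 (AddCircle.haarAddCircle (T := (1 : ℝ))) ℂ with hL
  have hs : Summable fun n : ℕ => c n • (fourier (n : ℤ) : C(UnitAddCircle, ℂ)) := by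
    refine Summable.of_norm ?_
    simpa [norm_smul, fourier_norm] using hc
  have hv : HasSum (fun n : ℕ => c n • fourierLp (T := (1 : ℝ)) 2 (n : ℤ))
      (L (∑' n : ℕ, c n • (fourier (n : ℤ) : C(UnitAddCircle, ℂ)))) := by
    simpa using hs.hasSum.mapL L
  set v := L (∑' n : ℕ, c n • (fourier (n : ℤ) : C(UnitAddCircle, ℂ)))
  have ho := orthonormal_fourier (T := (1 : ℝ))
  have hi : ∀ n : ℕ, inner ℂ (fourierLp (T := (1 : ℝ)) 2 (n : ℤ)) v = c n := by
    intro n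
    have h1 := hv.mapL (innerSL ℂ (fourierLp (T := (1 : ℝ)) 2 (n : ℤ)))
    have h2 := hasSum_single (f := fun m : ℕ => innerSL ℂ (fourierLp (T := (1 : ℝ)) 2 (n : ℤ))
      (c m • fourierLp (T := (1 : ℝ)) 2 (m : ℤ))) n (fun m hm => by
        simp [orthonormal_iff_ite.mp ho, Ne.symm hm])
    have h3 := h1.unique h2
    simpa [inner_smul_right, ho.1] using h3
  have h4 : HasSum (fun n : ℕ => inner ℂ v (c n • fourierLp (T := (1 : ℝ)) 2 (n : ℤ)))
      (inner ℂ v v) := hv.mapL (innerSL ℂ v)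
  have h5 : HasSum (fun n => ((‖c n‖ ^ 2 : ℝ) : ℂ)) ((‖v‖ ^ 2 : ℝ) : ℂ) := by
    have e : (fun n : ℕ => inner ℂ v (c n • fourierLp (T := (1 : ℝ)) 2 (n : ℤ)))
        = fun n => ((‖c n‖ ^ 2 : ℝ) : ℂ) := by
      funext n
      have : inner ℂ v (fourierLp (T := (1 : ℝ)) 2 (n : ℤ)) = (starRingEnd ℂ) (c n) := by
        rw [← hi n, inner_conj_symm]
      rw [inner_smul_right, this, Complex.mul_conj, Complex.normSq_eq_norm_sq]
    rw [e, inner_self_eq_norm_sq_to_K] at h4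
    simpa using h4
  exact_mod_cast h5

/-- If `g = φ f` on the disc with `φ` bounded by `C`, the Taylor coefficients satisfy
`‖g‖₂ ≤ C ‖f‖₂`. -/
theorem sum_sq_le_of_mul {a : SqSum} {b : ℕ → ℂ} {φ g : ℂ → ℂ} {C : ℝ}
    (hφ : ∀ z : ℂ, ‖z‖ < 1 → ‖φ z‖ ≤ C)
    (hg : ∀ z : ℂ, ‖z‖ < 1 → HasSum (fun n => b n * z ^ n) (g z))
    (hfg : ∀ z : ℂ, ‖z‖ < 1 → g z = φ z * ∑' n : ℕ, a n * z ^ n) (s : Finset ℕ) :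
    ∑ n ∈ s, ‖b n‖ ^ 2 ≤ (C * ‖a‖) ^ 2 := by
  have hC : 0 ≤ C := (norm_nonneg _).trans (hφ 0 (by simp))
  have ha2 : HasSum (fun n => ‖a n‖ ^ 2) (‖a‖ ^ 2) := by
    have := lp.hasSum_norm (p := 2) (by norm_num) a
    simpa using this
  have key : ∀ r : ℝ, 0 ≤ r → r < 1 → ∑ n ∈ s, ‖b n * (r : ℂ) ^ n‖ ^ 2 ≤ (C * ‖a‖) ^ 2 := by
    intro r hr0 hr1
    have hrn : ‖(r : ℂ)‖ < 1 := by simpa [abs_of_nonneg hr0] using hr1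
    have sa : Summable fun n => ‖a n * (r : ℂ) ^ n‖ := summable_coeff_mul_pow a hrn
    have sb : Summable fun n => ‖b n * (r : ℂ) ^ n‖ := by
      have := (hg r hrn).summable
      exact this.norm
    have Ha := norm_sq_toLp_tsum_fourier sa
    have Hb := norm_sq_toLp_tsum_fourier sb
    have hval : ∀ {c : ℕ → ℂ}, (Summable fun n => ‖c n * (r : ℂ) ^ n‖) → ∀ t : UnitAddCircle,
        (∑' n : ℕ, (c n * (r : ℂ) ^ n) • (fourier (n : ℤ) : C(UnitAddCircle, ℂ))) t
          = ∑' n : ℕ, c n * ((r : ℂ) * fourier 1 t) ^ n := by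
      intro c sc t
      have hs : Summable fun n : ℕ =>
          (c n * (r : ℂ) ^ n) • (fourier (n : ℤ) : C(UnitAddCircle, ℂ)) := by
        refine Summable.of_norm ?_
        simpa [norm_smul, fourier_norm] using sc
      rw [← ContinuousMap.tsum_apply hs]
      refine tsum_congr fun n => ?_
      have : (fourier (n : ℤ) t : ℂ) = (fourier 1 t) ^ n := by
        simp [fourier_apply, AddCircle.toCircle_nsmul]
      simp only [ContinuousMap.smul_apply, smul_eq_mul, this]
      ring
    have hle : ‖ContinuousMap.toLp (E := ℂ) 2 AddCircle.haarAddCircle ℂ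
          (∑' n : ℕ, (b n * (r : ℂ) ^ n) • (fourier (n : ℤ) : C(UnitAddCircle, ℂ)))‖
        ≤ C * ‖ContinuousMap.toLp (E := ℂ) 2 AddCircle.haarAddCircle ℂ
          (∑' n : ℕ, (a n * (r : ℂ) ^ n) • (fourier (n : ℤ) : C(UnitAddCircle, ℂ)))‖ := by
      refine MeasureTheory.Lp.norm_le_mul_norm_of_ae_le_mul ?_
      filter_upwards [ContinuousMap.coeFn_toLp (p := 2) (𝕜 := ℂ)
          (AddCircle.haarAddCircle (T := (1 : ℝ)))
          (∑' n : ℕ, (a n * (r : ℂ) ^ n) • (fourier (n : ℤ) : C(UnitAddCircle, ℂ))),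
        ContinuousMap.coeFn_toLp (p := 2) (𝕜 := ℂ)
          (AddCircle.haarAddCircle (T := (1 : ℝ)))
          (∑' n : ℕ, (b n * (r : ℂ) ^ n) • (fourier (n : ℤ) : C(UnitAddCircle, ℂ)))] with t h1 h2
      have hz : ‖(r : ℂ) * fourier 1 t‖ < 1 := by
        have : ‖(fourier 1 t : ℂ)‖ = 1 := by
          rw [fourier_one]
          exact Circle.norm_coe _
        rw [norm_mul, this, mul_one]; exact hrn
      rw [h1, h2, hval sa, hval sb, (hg _ hz).tsum_eq, hfg _ hz, norm_mul]
      exact mul_le_mul_of_nonneg_right (hφ _ hz) (norm_nonneg _)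
    have hle2 := pow_le_pow_left₀ (norm_nonneg _) hle 2
    calc ∑ n ∈ s, ‖b n * (r : ℂ) ^ n‖ ^ 2 ≤ _ := sum_le_hasSum s (fun _ _ => by positivity) Hb
      _ ≤ _ := hle2
      _ ≤ (C * ‖a‖) ^ 2 := by
        rw [mul_pow, mul_pow]
        refine mul_le_mul_of_nonneg_left ?_ (by positivity)
        refine hasSum_le (fun n => ?_) Ha ha2
        rw [norm_mul, norm_pow]
        have : ‖(r : ℂ)‖ ^ n ≤ 1 := pow_le_one₀ (norm_nonneg _) hrn.le
        have h0 := norm_nonneg (a n)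
        gcongr
        nlinarith
  have hcont : Filter.Tendsto (fun r : ℝ => ∑ n ∈ s, ‖b n * (r : ℂ) ^ n‖ ^ 2) (𝓝[<] 1)
      (𝓝 (∑ n ∈ s, ‖b n‖ ^ 2)) := by
    have : Continuous fun r : ℝ => ∑ n ∈ s, ‖b n * (r : ℂ) ^ n‖ ^ 2 := by fun_prop
    simpa using (this.tendsto 1).mono_left nhdsWithin_le_nhds
  refine le_of_tendsto hcont ?_
  filter_upwards [Ioo_mem_nhdsLT (show (0 : ℝ) < 1 by norm_num)] with r hr
  exact key r hr.1.le hr.2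

/-- The space `H^∞` of bounded holomorphic functions on the open unit disc. Such a function is
given by a function on `ℂ`, of which only the restriction to the disc matters. -/
structure HInfty where
  toFun : ℂ → ℂ
  holomorphic : DifferentiableOn ℂ toFun (Metric.ball 0 1)
  bounded : ∃ C : ℝ, ∀ z ∈ Metric.ball (0 : ℂ) 1, ‖toFun z‖ ≤ C

instance : CoeFun HInfty (fun _ => ℂ → ℂ) := ⟨HInfty.toFun⟩

/-- The function `z`. -/
def HInfty.z : HInfty where
  toFun := id
  holomorphic := differentiableOn_id
  bounded := ⟨1, fun _ hz => (mem_ball_zero_iff.mp hz).le⟩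

theorem exists_mul (φ : HInfty) (f : H2) : ∃ g : H2, (∀ z : UnitDisc, g z = φ z * f z) ∧
    ∀ C : ℝ, (∀ z ∈ Metric.ball (0 : ℂ) 1, ‖φ z‖ ≤ C) → ‖g‖ ≤ C * ‖f‖ := by
  set a := coeff f
  have hf : ∀ z : ℂ, ‖z‖ < 1 → HasSum (fun n => a n * z ^ n) (∑' n : ℕ, a n * z ^ n) :=
    fun z hz => (summable_coeff_mul_pow a hz).of_norm.hasSum
  have hfd : DifferentiableOn ℂ (fun z => ∑' n : ℕ, a n * z ^ n) (Metric.ball 0 1) := by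
    have := (hasFPowerSeriesOnBall_of_hasSum hf).differentiableOn
    have h1 : Metric.eball (0 : ℂ) 1 = Metric.ball 0 1 := by
      simpa using Metric.eball_ofReal (x := (0 : ℂ)) (ε := 1)
    rwa [h1] at this
  set g : ℂ → ℂ := fun z => φ z * ∑' n : ℕ, a n * z ^ n with hgdef
  have hgd : DifferentiableOn ℂ g (Metric.ball 0 1) := φ.holomorphic.mul hfd
  set b : ℕ → ℂ := fun n => ((n.factorial : ℂ))⁻¹ * iteratedDeriv n g 0
  have hg : ∀ z : ℂ, ‖z‖ < 1 → HasSum (fun n => b n * z ^ n) (g z) := by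
    intro z hz
    have := Complex.hasSum_taylorSeries_on_ball (r := (1 : ℝ)) (f := g) (c := 0) (z := z)
      (by simpa using hgd) (by simpa using hz)
    have e : (fun n => b n * z ^ n) =
        fun n => ((n.factorial : ℂ))⁻¹ • (z - 0) ^ n • iteratedDeriv n g 0 := by
      funext n
      simp only [b, smul_eq_mul, sub_zero]
      ring
    rw [e]
    exact this
  have hbd : ∀ C : ℝ, (∀ z ∈ Metric.ball (0 : ℂ) 1, ‖φ z‖ ≤ C) → ∀ s : Finset ℕ,
      ∑ n ∈ s, ‖b n‖ ^ 2 ≤ (C * ‖a‖) ^ 2 := fun C hC s =>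
    sum_sq_le_of_mul (fun z hz => hC z (mem_ball_zero_iff.mpr hz)) hg (fun z _ => rfl) s
  obtain ⟨C₀, hC₀⟩ := φ.bounded
  have hsum : Summable fun n => ‖b n‖ ^ 2 :=
    summable_of_sum_le (fun _ => by positivity) (hbd C₀ hC₀)
  have hmem : Memℓp b 2 := memℓp_gen (by simpa using hsum)
  refine ⟨coeff.symm ⟨b, hmem⟩, fun z => ?_, fun C hC => ?_⟩
  · have h1 := (coeff.symm ⟨b, hmem⟩ : H2).hasSum z
    rw [LinearEquiv.apply_symm_apply] at h1
    have h2 := hg z z.norm_lt_one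
    rw [h1.unique h2, hgdef]
    exact congrArg _ ((hf z z.norm_lt_one).unique (f.hasSum z))
  · have h1 : ‖(coeff.symm ⟨b, hmem⟩ : H2)‖ = ‖(⟨b, hmem⟩ : SqSum)‖ := by
      rw [H2.norm_eq, LinearEquiv.apply_symm_apply]
    have h2 : HasSum (fun n => ‖b n‖ ^ 2) (‖(⟨b, hmem⟩ : SqSum)‖ ^ 2) := by
      have := lp.hasSum_norm (p := 2) (by norm_num) (⟨b, hmem⟩ : SqSum)
      simp only [ENNReal.toReal_ofNat, Real.rpow_ofNat] at this
      exact this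
    have hC0 : 0 ≤ C := (norm_nonneg _).trans (hC 0 (by simp))
    rw [h1]
    have h3 : ‖(⟨b, hmem⟩ : SqSum)‖ ^ 2 ≤ (C * ‖a‖) ^ 2 := le_of_tendsto' h2 (hbd C hC)
    exact (sq_le_sq₀ (norm_nonneg _) (mul_nonneg hC0 (norm_nonneg a))).mp h3

/-- The product `φ f`, as an element of the Hardy space. -/
def mulFun (φ : HInfty) (f : H2) : H2 := (exists_mul φ f).choose

theorem mulFun_apply (φ : HInfty) (f : H2) (z : UnitDisc) : mulFun φ f z = φ z * f z :=
  (exists_mul φ f).choose_spec.1 z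

theorem norm_mulFun_le (φ : HInfty) (f : H2) {C : ℝ}
    (hC : ∀ z ∈ Metric.ball (0 : ℂ) 1, ‖φ z‖ ≤ C) : ‖mulFun φ f‖ ≤ C * ‖f‖ :=
  (exists_mul φ f).choose_spec.2 C hC

theorem H2.coe_add (f g : H2) (z : UnitDisc) : (f + g : H2) z = f z + g z := rfl

theorem H2.coe_smul (c : ℂ) (f : H2) (z : UnitDisc) : (c • f : H2) z = c * f z := rfl

/-- Multiplication by `φ`, as a linear map. -/
def mulLin (φ : HInfty) : H2 →ₗ[ℂ] H2 where
  toFun := mulFun φ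
  map_add' f g := H2.ext fun z => by
    simp only [H2.coe_add, mulFun_apply, mul_add]
  map_smul' c f := H2.ext fun z => by
    simp only [H2.coe_smul, mulFun_apply, RingHom.id_apply]
    ring

/-- The operator `M_φ` of multiplication by `φ` on the Hardy space. -/
def mulOp (φ : HInfty) : H2 →L[ℂ] H2 :=
  (mulLin φ).mkContinuousOfExistsBound
    (φ.bounded.imp fun _ hC f => norm_mulFun_le φ f hC)

theorem mulOp_apply (φ : HInfty) (f : H2) (z : UnitDisc) : mulOp φ f z = φ z * f z :=
  mulFun_apply φ f z

/-- Arc-length measure on the unit circle, as a measure on `ℂ`. -/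
def arcLength : MeasureTheory.Measure ℂ :=
  (MeasureTheory.volume.restrict (Set.Ioc (-Real.pi) Real.pi)).map
    fun θ : ℝ => Complex.exp (θ * Complex.I)

/-- A bounded holomorphic function on the disc is inner if at almost every point of the unit circle
it has a radial limit of modulus one. -/
def HInfty.IsInner (φ : HInfty) : Prop :=
  ∀ᵐ ζ ∂arcLength, ∃ c : ℂ, ‖c‖ = 1 ∧
    Filter.Tendsto (fun r : ℝ => φ (r * ζ)) (𝓝[<] 1) (𝓝 c)

end Hardy

/-! ### Pairs of commuting isometries -/

namespace BiIsometry

open ContinuousLinearMap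

variable {H : Type*} [NormedAddCommGroup H] [InnerProductSpace ℂ H]
variable {K : Type*} [NormedAddCommGroup K] [InnerProductSpace ℂ K]

/-- A bi-isometry: a commuting pair of isometries, an isometry being an operator `T` with
`T* T = I`. -/
structure IsBiIsometry [CompleteSpace H] (S₁ S₂ : H →L[ℂ] H) : Prop where
  commute : S₁ ∘L S₂ = S₂ ∘L S₁
  isometry_fst : adjoint S₁ ∘L S₁ = .id ℂ H
  isometry_snd : adjoint S₂ ∘L S₂ = .id ℂ H

/-- A doubly commuting pair: `S₁ S₂ = S₂ S₁` and `S₁* S₂ = S₂ S₁*`. -/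
structure IsDoublyCommuting [CompleteSpace H] (S₁ S₂ : H →L[ℂ] H) : Prop where
  commute : S₁ ∘L S₂ = S₂ ∘L S₁
  adjoint_commute : adjoint S₁ ∘L S₂ = S₂ ∘L adjoint S₁

/-- The closed subspace `M` reduces `T`: both `M` and its orthogonal complement are invariant. -/
structure Reduces (M : Submodule ℂ H) (T : H →L[ℂ] H) : Prop where
  isClosed : IsClosed (M : Set H)
  invariant : ∀ x ∈ M, T x ∈ M
  invariant_orthogonal : ∀ x ∈ Mᗮ, T x ∈ Mᗮ

/-- `M` reduces the pair `(S₁, S₂)` to a doubly commuting bi-isometry on `M`. -/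
def ReducesToDoublyCommutingBiIsometry (M : Submodule ℂ H) [CompleteSpace M]
    (S₁ S₂ : H →L[ℂ] H) : Prop :=
  ∃ (h₁ : Reduces M S₁) (h₂ : Reduces M S₂),
    IsBiIsometry (S₁.restrict h₁.invariant) (S₂.restrict h₂.invariant) ∧
    IsDoublyCommuting (S₁.restrict h₁.invariant) (S₂.restrict h₂.invariant)

/-- The hyper-range `⋂ₙ Tⁿ H`. -/
def hyperRange (T : H →L[ℂ] H) : Submodule ℂ H :=
  ⨅ n : ℕ, LinearMap.range ((T ^ n : H →L[ℂ] H) : H →ₗ[ℂ] H)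

theorem mem_hyperRange {T : H →L[ℂ] H} {x : H} :
    x ∈ hyperRange T ↔ ∀ n : ℕ, ∃ y, (T ^ n) y = x := by
  simp only [hyperRange, Submodule.mem_iInf, LinearMap.mem_range]
  rfl

theorem apply_mem_hyperRange (T : H →L[ℂ] H) (x : H) (hx : x ∈ hyperRange T) :
    T x ∈ hyperRange T := by
  rw [mem_hyperRange] at hx ⊢
  intro n
  obtain ⟨y, rfl⟩ := hx n
  refine ⟨T y, ?_⟩
  change (T ^ n * T) y = (T * T ^ n) y
  rw [← pow_succ, ← pow_succ']

/-- The restriction of `T` to its hyper-range. -/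
def hyperRangePart (T : H →L[ℂ] H) : hyperRange T →L[ℂ] hyperRange T :=
  T.restrict (apply_mem_hyperRange T)

theorem completeSpace_hyperRange [CompleteSpace H] {T : H →L[ℂ] H}
    (hT : adjoint T ∘L T = .id ℂ H) : CompleteSpace (hyperRange T) := by
  have hn : ∀ x, ‖T x‖ = ‖x‖ := (norm_map_iff_adjoint_comp_self T).mpr hT
  have hp : ∀ n : ℕ, ∀ x, ‖(T ^ n) x‖ = ‖x‖ := by
    intro n
    induction n with
    | zero => simp
    | succ n ih => intro x; rw [pow_succ]; exact (ih (T x)).trans (hn x)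
  have hc : IsClosed (hyperRange T : Set H) := by
    have : (hyperRange T : Set H) = ⋂ n : ℕ, Set.range (T ^ n : H →L[ℂ] H) := by
      ext x
      simp only [SetLike.mem_coe, mem_hyperRange, Set.mem_iInter, Set.mem_range]
    rw [this]
    exact isClosed_iInter fun n =>
      (AddMonoidHomClass.isometry_of_norm _ (hp n)).isClosedEmbedding.isClosed_range
  exact hc.completeSpace_coe

theorem IsBiIsometry.completeSpace_hyperRange [CompleteSpace H] {S₁ S₂ : H →L[ℂ] H}
    (h : IsBiIsometry S₁ S₂) : CompleteSpace (hyperRange S₁) :=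
  BiIsometry.completeSpace_hyperRange h.isometry_fst

/-- The operator on `K ⊕ L` with upper triangular block matrix `[A B; 0 D]`. -/
def blockUpper {L : Type*} [NormedAddCommGroup L] [InnerProductSpace ℂ L]
    (A : K →L[ℂ] K) (B : L →L[ℂ] K) (D : L →L[ℂ] L) :
    WithLp 2 (K × L) →L[ℂ] WithLp 2 (K × L) :=
  (WithLp.prodContinuousLinearEquiv 2 ℂ K L).symm.toContinuousLinearMap ∘L
    ((A.coprod B).prod (D ∘L .snd ℂ K L)) ∘L
      (WithLp.prodContinuousLinearEquiv 2 ℂ K L).toContinuousLinearMap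

theorem blockUpper_apply {L : Type*} [NormedAddCommGroup L] [InnerProductSpace ℂ L]
    (A : K →L[ℂ] K) (B : L →L[ℂ] K) (D : L →L[ℂ] L) (x : WithLp 2 (K × L)) :
    blockUpper A B D x = WithLp.toLp 2 (A x.fst + B x.snd, D x.snd) := rfl

/-- Unitary equivalence of pairs of operators. -/
def UnitarilyEquivalent (S₁ S₂ : H →L[ℂ] H) (T₁ T₂ : K →L[ℂ] K) : Prop :=
  ∃ W : H ≃ₗᵢ[ℂ] K, (∀ x, W (S₁ x) = T₁ (W x)) ∧ ∀ x, W (S₂ x) = T₂ (W x)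

open Hardy in
/-- The data `(U, A, B, φ)` form a model of the pair `(S₁, S₂)` on `K ⊕ H²`:
`S₁ ≅ [U 0; 0 M_z]` and `S₂ ≅ [A B; 0 M_φ]`, simultaneously. -/
structure IsModel [CompleteSpace K] (S₁ S₂ : H →L[ℂ] H)
    (U A : K →L[ℂ] K) (B : H2 →L[ℂ] K) (φ : HInfty) : Prop where
  unitary : U ∈ unitary (K →L[ℂ] K)
  norm_le_one : ∀ z ∈ Metric.ball (0 : ℂ) 1, ‖φ z‖ ≤ 1
  isometry : adjoint A ∘L A = .id ℂ K
  commute : U ∘L A = A ∘L U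
  intertwine : U ∘L B = B ∘L mulOp HInfty.z
  adjoint_comp : adjoint A ∘L B = 0
  sum_eq : adjoint B ∘L B + adjoint (mulOp φ) ∘L mulOp φ = .id ℂ H2
  equivalent : UnitarilyEquivalent S₁ S₂
    (blockUpper U 0 (mulOp HInfty.z)) (blockUpper A B (mulOp φ))

end BiIsometry

end

/-! The Wold decomposition of `S₁` splits the space into the hyper-range, on which `S₁` is unitary,
and a copy of `H²`, on which `S₁` is the shift, because `ker S₁*` is one-dimensional. Since `S₂`
commutes with `S₁`, it preserves the hyper-range, so it is block upper triangular. Its lower corner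
is a contraction commuting with the shift, hence some `M_φ` with `|φ| ≤ 1`. The remaining model
relations are the block entries of `S₁S₂ = S₂S₁` and `S₂*S₂ = I`. This is
`IsBiIsometry.exists_isModel`.

The spectral hypothesis enters through `intertwiner_eq_zero`. If `UB = BM_z`, then `‖f(U)B1‖ ≤ ‖B‖
‖f‖₂` for continuous `f` on the circle: multiplying a trigonometric polynomial by a high power of
`z` makes it analytic and changes neither side. When `σ(U)` is null, a continuous `f` can equal one
on `σ(U)` and have arbitrarily small `L²`-norm. Then `f(U) = I`, so `B1 = 0`, and `B = 0` because
`Bzⁿ = UⁿB1`.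

With `B = 0` the operator `M_φ` is an isometry, so `‖φ‖₂ = 1`. Boundary values exist by Fatou's
theorem and have modulus at most one; by Parseval their mean square is one, so their modulus is one
almost everywhere. Fatou's theorem is proved through a Lipschitz primitive of `φ`, which is
differentiable at almost every point along the circle. Finally, `B = 0` makes `S₂` block diagonal,
and on the hyper-range the unitarity of `S₁` turns commutation into double commutation. -/

noncomputable section

/-! ### Radial limits of bounded holomorphic functions -/

namespace Hardy

open Complex Metric Filter

/-- Cauchy's formula for the derivative, with continuous boundary values. -/
theorem deriv_eq_circleAverage {f : ℂ → ℂ} (hf : DiffContOnCl ℂ f (ball 0 1)) {w : ℂ}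
    (hw : w ∈ ball (0 : ℂ) 1) :
    deriv f w = Real.circleAverage (fun z => z / (z - w) ^ 2 * f z) 0 1 := by
  have hcont : ContinuousOn f (sphere 0 1) := hf.continuousOn_ball.mono sphere_subset_closedBall
  have hci : CircleIntegrable f 0 1 := hcont.circleIntegrable zero_le_one
  have h1 := hasDerivAt_circleAverage_herglotzRieszKernel_smul hci hw
  -- The kernel `(z + w)/(z - w)` equals `2z/(z - w) - 1`, so Cauchy's formula and the mean value
  -- property give `2f(w) - f(0)`. Differentiating in `w` produces the kernel `2z/(z - w)²`.
  have h2 : (fun w => Real.circleAverage (fun ζ => herglotzRieszKernel 0 w ζ • f ζ) 0 1)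
      =ᶠ[𝓝 w] fun w => 2 * f w - f 0 := by
    filter_upwards [isOpen_ball.mem_nhds hw] with v hv
    have hv' : v ∈ ball (0 : ℂ) |1| := by simpa using hv
    have hf' : DiffContOnCl ℂ f (ball 0 |1|) := by simpa using hf
    have hne : ∀ z ∈ sphere (0 : ℂ) 1, z - v ≠ 0 := fun z hz h => by
      rw [sub_eq_zero] at h; subst h; simp at hz hv; linarith
    have e1 := hf'.circleAverage_smul_div hv'
    have e2 : Real.circleAverage f 0 1 = f 0 := hf'.circleAverage
    simp only [sub_zero, smul_eq_mul] at e1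
    rw [← e2, ← e1, ← smul_eq_mul, ← Real.circleAverage_fun_smul, ← Real.circleAverage_fun_sub]
    · refine Real.circleAverage_congr_sphere fun z hz => ?_
      have := hne z (by simpa using hz)
      simp only [herglotzRieszKernel_def, sub_zero, smul_eq_mul]
      field_simp
      ring
    · refine ContinuousOn.circleIntegrable zero_le_one ?_
      fun_prop (disch := simpa using hne)
    · exact hci
  have h3 := (h1.congr_of_eventuallyEq h2.symm)
  have hd : HasDerivAt f (deriv f w) w :=
    (hf.differentiableOn.differentiableAt (isOpen_ball.mem_nhds hw)).hasDerivAt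
  have h4 := h3.unique ((hd.const_mul 2).sub_const (f 0))
  have h5 : Real.circleAverage (fun ζ => (2 * ζ / (ζ - w) ^ 2) • f ζ) 0 1
      = 2 * Real.circleAverage (fun z => z / (z - w) ^ 2 * f z) 0 1 := by
    rw [← smul_eq_mul, ← Real.circleAverage_fun_smul]
    congr 1
    funext z
    simp only [smul_eq_mul]
    ring
  rw [h5] at h4
  exact (mul_left_cancel₀ two_ne_zero h4).symm

/-- With the pole outside the closed disc the integrand is holomorphic and vanishes at the origin.
This allows a reflected kernel to be subtracted from Cauchy's at no cost. -/
theorem circleAverage_div_sub_sq_mul_eq_zero {f : ℂ → ℂ} (hf : DiffContOnCl ℂ f (ball 0 1)) {w : ℂ}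
    (hw : 1 < ‖w‖) :
    Real.circleAverage (fun z => z / (z - w) ^ 2 * f z) 0 1 = 0 := by
  have hg : DiffContOnCl ℂ (fun z => z / (z - w) ^ 2 * f z) (ball 0 |1|) := by
    rw [abs_one]
    refine DiffContOnCl.smul (c := fun z : ℂ => z / (z - w) ^ 2) (F := ℂ)
      (DifferentiableOn.diffContOnCl ?_) hf
    rw [closure_ball _ one_ne_zero]
    have : ∀ z ∈ closedBall (0 : ℂ) 1, (z - w) ^ 2 ≠ 0 := fun z hz h => by
      have h' : z = w := by simpa [sub_eq_zero] using h
      subst h'; simp at hz; linarith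
    fun_prop (disch := simpa using this)
  simpa using hg.circleAverage

/-- The points `rζ` and `ζ/r` are reflections of each other in the circle, so their distances to `z`
differ only by the factor `r`. The difference of the kernels therefore gains a factor `1 - r`, which
makes it comparable to the Poisson kernel divided by `‖z - rζ‖`. -/
theorem norm_kernel_le {z ζ : ℂ} (hz : ‖z‖ = 1) (hζ : ‖ζ‖ = 1) {r : ℝ} (hr0 : 0 < r) (hr1 : r < 1) :
    ‖z / (z - r * ζ) ^ 2 - z / (z - ζ / r) ^ 2‖ ≤ 4 * (1 - r) / ‖z - r * ζ‖ ^ 3 := by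
  have hrc : (r : ℂ) ≠ 0 := by exact_mod_cast hr0.ne'
  set w := z - r * ζ with hwdef
  set w' := z - ζ / r with hw'def
  have hw0 : w ≠ 0 := fun h => by
    have h1 : z = r * ζ := sub_eq_zero.mp h
    rw [h1, norm_mul, hζ] at hz; simp [abs_of_pos hr0] at hz; linarith
  have hwpos : 0 < ‖w‖ := norm_pos_iff.mpr hw0
  have hnorm : ‖w'‖ = ‖w‖ / r := by
    have hzz : z * (starRingEnd ℂ) z = 1 := by rw [Complex.mul_conj, normSq_eq_norm_sq, hz]; simp
    have hζζ : ζ * (starRingEnd ℂ) ζ = 1 := by rw [Complex.mul_conj, normSq_eq_norm_sq, hζ]; simp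
    have e : r * w' = - (z * ζ * (starRingEnd ℂ) w) := by
      simp only [hwdef, hw'def, map_sub, map_mul, Complex.conj_ofReal]
      field_simp
      linear_combination (ζ) * hzz - r * z * hζζ
    have := congrArg norm e
    rw [norm_neg, norm_mul, norm_mul, norm_mul, hz, hζ, RCLike.norm_conj] at this
    simp [abs_of_pos hr0] at this
    rw [eq_div_iff hr0.ne']; linarith
  have hw'0 : w' ≠ 0 := by rw [← norm_pos_iff, hnorm]; positivity
  have e : z / w ^ 2 - z / w' ^ 2 = z * ((w' - w) * (w' + w)) / (w ^ 2 * w' ^ 2) := by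
    field_simp; ring
  have hd : ‖w' - w‖ = (1 - r ^ 2) / r := by
    have : w' - w = -(((1 - r ^ 2) / r : ℝ) : ℂ) * ζ := by
      simp only [hwdef, hw'def]; push_cast; field_simp; ring
    rw [this, norm_mul, norm_neg, hζ, mul_one, Complex.norm_real, Real.norm_of_nonneg]
    have : 0 ≤ 1 - r ^ 2 := by nlinarith
    positivity
  have hs : ‖w' + w‖ ≤ ‖w‖ * (1 + r) / r := by
    refine (norm_add_le _ _).trans (le_of_eq ?_)
    rw [hnorm]; field_simp
  rw [e, norm_div, norm_mul, norm_mul, norm_mul, norm_pow, norm_pow, hz, hnorm, hd, one_mul]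
  calc (1 - r ^ 2) / r * ‖w' + w‖ / (‖w‖ ^ 2 * (‖w‖ / r) ^ 2)
      ≤ (1 - r ^ 2) / r * (‖w‖ * (1 + r) / r) / (‖w‖ ^ 2 * (‖w‖ / r) ^ 2) := by
        have : 0 ≤ 1 - r ^ 2 := by nlinarith
        gcongr
    _ = (1 - r) * (1 + r) ^ 2 / ‖w‖ ^ 3 := by field_simp; ring
    _ ≤ _ := by
        rw [mul_comm (4 : ℝ)]
        have h4 : (1 + r) ^ 2 ≤ 4 := by nlinarith
        have h1 : 0 ≤ 1 - r := by linarith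
        gcongr

theorem circleAverage_poissonKernel {w : ℂ} (hw : w ∈ ball (0 : ℂ) 1) :
    Real.circleAverage (poissonKernel 0 w) 0 1 = 1 := by
  have h := DiffContOnCl.circleAverage_poissonKernel_smul
    (f := fun _ : ℂ => (1 : ℂ)) diffContOnCl_const hw
  have h2 : Real.circleAverage (poissonKernel 0 w • fun _ : ℂ => (1 : ℂ)) 0 1
      = ((Real.circleAverage (poissonKernel 0 w) 0 1 : ℝ) : ℂ) := by
    simp only [Real.circleAverage_def, Pi.smul_apply', Complex.real_smul, mul_one,
      intervalIntegral.integral_ofReal]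
    simp
  rw [h2] at h
  exact_mod_cast h

theorem continuousOn_poissonKernel {w : ℂ} (hw : w ∈ ball (0 : ℂ) 1) :
    ContinuousOn (poissonKernel 0 w) (sphere 0 1) := by
  rw [poissonKernel_eq_re_herglotzRieszKernel]
  exact Complex.continuous_re.comp_continuousOn
    (by simpa using continuousOn_herglotzRieszKernel_sphere hw)

theorem norm_circleAverage_le {f : ℂ → ℂ} {g : ℂ → ℝ} (hg : CircleIntegrable g 0 1)
    (h : ∀ z ∈ sphere (0 : ℂ) 1, ‖f z‖ ≤ g z) :
    ‖Real.circleAverage f 0 1‖ ≤ Real.circleAverage g 0 1 := by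
  rw [Real.circleAverage_def, Real.circleAverage_def, norm_smul, smul_eq_mul,
    Real.norm_of_nonneg (by positivity)]
  gcongr
  refine intervalIntegral.norm_integral_le_of_norm_le (by positivity)
    (Eventually.of_forall fun θ _ => h _ (by simp)) hg

/-- Near a boundary point at which the boundary values vanish to first order, the derivative tends
to zero radially. -/
theorem tendsto_deriv_radial_zero {h : ℂ → ℂ} {M : ℝ} (hf : DiffContOnCl ℂ h (ball 0 1))
    (hM : ∀ z ∈ sphere (0 : ℂ) 1, ‖h z‖ ≤ M) {ζ : ℂ} (hζ : ‖ζ‖ = 1)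
    (ho : h =o[𝓝[sphere 0 1] ζ] fun z => z - ζ) :
    Tendsto (fun r : ℝ => deriv h (r * ζ)) (𝓝[<] 1) (𝓝 0) := by
  have hM0 : 0 ≤ M := (norm_nonneg _).trans (hM ζ (by simpa using hζ))
  have key : ∀ ε : ℝ, 0 < ε → ∃ C : ℝ, ∀ r : ℝ, 0 < r → r < 1 →
      ‖deriv h (r * ζ)‖ ≤ 8 * ε + C * (1 - r) := by
    intro ε hε
    obtain ⟨δ, hδ, hδh⟩ := Metric.mem_nhdsWithin_iff.mp (ho.def hε)
    -- Away from `ζ` one has `‖z - w‖ ≥ δ/2`, and the kernel bound becomes `4(1 - r)/(δ/2)³ = 32(1 -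
    -- r)/δ³`. Near `ζ` the factor `‖h z‖ ≤ 2ε‖z - w‖` leaves at most `8ε` times the Poisson kernel,
    -- whose average is one.
    refine ⟨M * 32 / δ ^ 3, fun r hr0 hr1 => ?_⟩
    set w : ℂ := r * ζ with hw
    have hwn : ‖w‖ = r := by simp [hw, hζ, abs_of_pos hr0]
    have hwb : w ∈ ball (0 : ℂ) 1 := by simpa [hwn] using hr1
    have hw'n : 1 < ‖ζ / r‖ := by
      simp [hζ, abs_of_pos hr0]; exact (one_lt_inv₀ hr0).mpr hr1
    have hcont : ContinuousOn h (sphere 0 1) :=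
      hf.continuousOn_ball.mono sphere_subset_closedBall
    have hne : ∀ z ∈ sphere (0 : ℂ) 1, z - w ≠ 0 := fun z hz h => by
      rw [sub_eq_zero] at h; subst h; simp at hz; linarith
    have hne' : ∀ z ∈ sphere (0 : ℂ) 1, z - ζ / r ≠ 0 := fun z hz h => by
      rw [sub_eq_zero] at h; subst h; simp at hz; simp at hw'n; linarith
    have e : deriv h w = Real.circleAverage
        (fun z => (z / (z - w) ^ 2 - z / (z - ζ / r) ^ 2) * h z) 0 1 := by
      have e1 := deriv_eq_circleAverage hf hwb
      have e2 := circleAverage_div_sub_sq_mul_eq_zero hf hw'n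
      simp only [sub_mul]
      rw [Real.circleAverage_fun_sub, ← e1, e2, sub_zero]
      · refine ContinuousOn.circleIntegrable zero_le_one ?_
        fun_prop (disch := simpa using hne)
      · refine ContinuousOn.circleIntegrable zero_le_one ?_
        fun_prop (disch := simpa using hne')
    have hPi : CircleIntegrable (fun z => (8 * ε) • poissonKernel 0 w z) 0 1 :=
      ((continuousOn_poissonKernel hwb).const_smul (8 * ε)).circleIntegrable zero_le_one
    have hCi : CircleIntegrable (fun _ : ℂ => M * 32 / δ ^ 3 * (1 - r)) 0 1 :=
      circleIntegrable_const _ _ _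
    rw [e]
    refine (norm_circleAverage_le (g := fun z => (8 * ε) • poissonKernel 0 w z
        + M * 32 / δ ^ 3 * (1 - r)) (hPi.add hCi) fun z hz => ?_).trans (le_of_eq ?_)
    · have hz1 : ‖z‖ = 1 := by simpa using hz
      have hpos : 0 < ‖z - w‖ := norm_pos_iff.mpr (hne z hz)
      have hk := norm_kernel_le hz1 hζ hr0 hr1
      rw [← hw] at hk
      have h1r : 1 - r ≤ ‖z - w‖ := by
        have := norm_sub_norm_le z w
        rw [hz1, hwn] at this; exact this
      have hζw : ‖ζ - w‖ = 1 - r := by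
        have : ζ - w = ((1 - r : ℝ) : ℂ) * ζ := by rw [hw]; push_cast; ring
        rw [this, norm_mul, hζ, mul_one, Complex.norm_real, Real.norm_of_nonneg (by linarith)]
      have h2 : ‖z - ζ‖ ≤ 2 * ‖z - w‖ := by
        have : z - ζ = (z - w) - (ζ - w) := by ring
        have h3 := norm_sub_le (z - w) (ζ - w)
        rw [← this] at h3; linarith
      have hP : poissonKernel 0 w z = (1 - r ^ 2) / ‖z - w‖ ^ 2 := by
        simp [poissonKernel_def, hz1, hwn]
      have h1r2 : 0 ≤ 1 - r ^ 2 := by nlinarith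
      have hr' : 0 ≤ 1 - r := by linarith
      rw [norm_mul, hP, smul_eq_mul]
      by_cases hzδ : ‖z - ζ‖ < δ
      · have h4 : ‖h z‖ ≤ ε * ‖z - ζ‖ := hδh ⟨by simpa [dist_eq_norm] using hzδ, hz⟩
        calc _ ≤ 4 * (1 - r) / ‖z - w‖ ^ 3 * (ε * (2 * ‖z - w‖)) := by gcongr; exact h4.trans (by gcongr)
          _ = 8 * ε * ((1 - r) / ‖z - w‖ ^ 2) := by field_simp; ring
          _ ≤ 8 * ε * ((1 - r ^ 2) / ‖z - w‖ ^ 2) := by gcongr; nlinarith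
          _ ≤ _ := le_add_of_nonneg_right (by positivity)
      · push Not at hzδ
        have h5 : δ / 2 ≤ ‖z - w‖ := by linarith
        calc _ ≤ 4 * (1 - r) / (δ / 2) ^ 3 * M := by
              gcongr
              · exact hk.trans (by gcongr)
              · exact hM z hz
          _ = M * 32 / δ ^ 3 * (1 - r) := by field_simp; ring
          _ ≤ _ := le_add_of_nonneg_left (by positivity)
    · rw [Real.circleAverage_fun_add hPi hCi, Real.circleAverage_fun_smul,
        circleAverage_poissonKernel hwb, Real.circleAverage_const, smul_eq_mul, mul_one]
  rw [Metric.tendsto_nhds]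
  intro ε hε
  obtain ⟨C, hC⟩ := key (ε / 16) (by positivity)
  have hlim : Tendsto (fun r : ℝ => C * (1 - r)) (𝓝[<] 1) (𝓝 0) := by
    have : Continuous fun r : ℝ => C * (1 - r) := by fun_prop
    simpa using (this.tendsto 1).mono_left nhdsWithin_le_nhds
  filter_upwards [hlim.eventually (gt_mem_nhds (show (0 : ℝ) < ε / 2 by positivity)),
    Ioo_mem_nhdsLT (show (0 : ℝ) < 1 by norm_num)] with r h1 h2
  have := hC r h2.1 h2.2
  rw [dist_zero_right]
  linarith


/-! ### Fatou's theorem. -/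

open MeasureTheory

theorem measurable_exp_ofReal_mul_I : Measurable fun θ : ℝ => exp (θ * I) := by
  have : Continuous fun θ : ℝ => exp (θ * I) := by fun_prop
  exact this.measurable

/-- The argument inverts `θ ↦ exp(iθ)` almost everywhere. Pulling back along it requires no
measurability of `p`, which would be awkward to establish for the existence of radial limits. -/
theorem ae_arcLength_of_ae {p : ℂ → Prop}
    (h : ∀ᵐ θ : ℝ ∂volume.restrict (Set.Ioc (-Real.pi) Real.pi), p (exp (θ * I))) :
    ∀ᵐ ζ ∂arcLength, p ζ := by
  have h1 : arcLength.map arg = volume.restrict (Set.Ioc (-Real.pi) Real.pi) := by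
    rw [arcLength, Measure.map_map measurable_arg measurable_exp_ofReal_mul_I]
    conv_rhs => rw [← Measure.map_id (μ := volume.restrict (Set.Ioc (-Real.pi) Real.pi))]
    refine Measure.map_congr ?_
    filter_upwards [ae_restrict_mem measurableSet_Ioc] with θ hθ
    simp only [Function.comp_apply, id]
    rw [exp_mul_I, arg_cos_add_sin_mul_I hθ]
  have h2 : ∀ᵐ ζ ∂arcLength, exp (arg ζ * I) = ζ := by
    rw [arcLength, ae_map_iff measurable_exp_ofReal_mul_I.aemeasurable
      (measurableSet_eq_fun (f := fun ζ : ℂ => exp (arg ζ * I)) (g := fun ζ => ζ)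
        (by fun_prop) measurable_id)]
    refine Eventually.of_forall fun θ => ?_
    have := norm_mul_exp_arg_mul_I (exp (θ * I))
    rwa [norm_exp_ofReal_mul_I, ofReal_one, one_mul] at this
  rw [← h1] at h
  filter_upwards [h2, ae_of_ae_map measurable_arg.aemeasurable h] with ζ e hζ
  rwa [e] at hζ

/-- **Fatou's theorem**: a bounded holomorphic function has radial limits almost everywhere. -/
theorem HInfty.ae_exists_radial_limit (φ : HInfty) :
    ∀ᵐ θ : ℝ, ∃ c : ℂ, Tendsto (fun r : ℝ => φ (r * exp (θ * I))) (𝓝[<] 1) (𝓝 c) := by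
  obtain ⟨C, hC⟩ := φ.bounded
  have hC0 : 0 ≤ C := (norm_nonneg _).trans (hC 0 (by simp))
  -- A primitive of a bounded function is Lipschitz. It extends to a Lipschitz function `F` on the
  -- plane, which is differentiable along the circle at almost every angle.
  obtain ⟨g, hg⟩ := φ.holomorphic.isExactOn_ball
  have hgl : LipschitzOnWith C.toNNReal g (ball 0 1) := by
    refine (convex_ball 0 1).lipschitzOnWith_of_nnnorm_hasDerivWithin_le
      (fun z hz => (hg z hz).hasDerivWithinAt) fun z hz => ?_
    rw [← NNReal.coe_le_coe, coe_nnnorm, Real.coe_toNNReal _ hC0]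
    exact hC z hz
  obtain ⟨F, hF, hFg⟩ := hgl.extend_finite_dimension
  set K := lipschitzExtensionConstant ℂ * C.toNNReal
  have hFd : ∀ z ∈ ball (0 : ℂ) 1, HasDerivAt F (φ z) z := fun z hz =>
    (hg z hz).congr_of_eventuallyEq (by
      filter_upwards [isOpen_ball.mem_nhds hz] with w hw using (hFg hw).symm)
  have hG := (hF.comp (lipschitzWith_circleMap 0 1)).ae_differentiableAt_real
  filter_upwards [hG] with θ hθ
  set ζ : ℂ := exp (θ * I) with hζdef
  have hζ : ‖ζ‖ = 1 := norm_exp_ofReal_mul_I θ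
  have hcm : ∀ t : ℝ, circleMap 0 1 t = exp (t * I) := fun t => by simp [circleMap]
  set d := deriv (F ∘ circleMap 0 1) θ
  have hζ0 : ζ ≠ 0 := exp_ne_zero _
  -- Dividing the angular derivative by the velocity `iζ` gives the candidate limit. The function
  -- `h` below vanishes to first order at `ζ` along the circle, and its derivative in the disc is `φ
  -- - c`.
  set c := d / (ζ * I)
  refine ⟨c, ?_⟩
  set h : ℂ → ℂ := fun z => F z - F ζ - c * (z - ζ) with hdef
  have hhd : ∀ z ∈ ball (0 : ℂ) 1, HasDerivAt h (φ z - c) z := fun z hz => by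
    have := ((hFd z hz).sub_const (F ζ)).sub (((hasDerivAt_id z).sub_const ζ).const_mul c)
    rwa [mul_one] at this
  have hFc := hF.continuous
  have hdc : DiffContOnCl ℂ h (ball 0 1) :=
    ⟨fun z hz => (hhd z hz).differentiableAt.differentiableWithinAt,
      (by fun_prop : Continuous h).continuousOn⟩
  have hM : ∀ z ∈ sphere (0 : ℂ) 1, ‖h z‖ ≤ (K + ‖c‖) * 2 := fun z hz => by
    have hz1 : ‖z‖ = 1 := by simpa using hz
    have h1 : ‖F z - F ζ‖ ≤ K * ‖z - ζ‖ := by simpa [dist_eq_norm] using hF.dist_le_mul z ζ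
    have h2 : ‖z - ζ‖ ≤ 2 := (norm_sub_le _ _).trans (by rw [hz1, hζ]; norm_num)
    calc ‖h z‖ ≤ ‖F z - F ζ‖ + ‖c * (z - ζ)‖ := norm_sub_le _ _
      _ ≤ K * ‖z - ζ‖ + ‖c‖ * ‖z - ζ‖ := by rw [norm_mul]; gcongr
      _ = (K + ‖c‖) * ‖z - ζ‖ := by ring
      _ ≤ _ := by gcongr
  have ho : h =o[𝓝[sphere 0 1] ζ] fun z => z - ζ := by
    have hcd : HasDerivAt (fun t : ℝ => h (circleMap 0 1 t)) 0 θ := by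
      have h1 := (hθ.hasDerivAt.sub_const (F ζ)).sub
        (((hasDerivAt_circleMap 0 1 θ).sub_const ζ).const_mul c)
      have : d - c * (circleMap 0 1 θ * I) = 0 := by
        rw [hcm, ← hζdef, div_mul_cancel₀ _ (mul_ne_zero hζ0 I_ne_zero), sub_self]
      rw [this] at h1
      exact h1
    have h2 : (fun t : ℝ => h (circleMap 0 1 t)) =o[𝓝 θ] fun t => t - θ := by
      have := hasDerivAt_iff_isLittleO.mp hcd
      have h0 : h (circleMap 0 1 θ) = 0 := by rw [hcm, ← hζdef]; simp [hdef]
      simpa only [h0, smul_zero, sub_zero] using this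
    -- A local inverse of the circle parametrization near `ζ`. It transfers the little-o estimate
    -- from the angle to the point, angles being at most `π/2` times chords.
    set τ : ℂ → ℝ := fun z => θ + arg (z / ζ) with hτ
    have hτt : Tendsto τ (𝓝[sphere 0 1] ζ) (𝓝 θ) := by
      have : ContinuousAt τ ζ := by
        refine continuousAt_const.add (ContinuousAt.comp (g := arg) ?_ (by fun_prop))
        rw [div_self hζ0]
        exact continuousAt_arg (by simp)
      have h3 := this.tendsto
      rw [show τ ζ = θ by simp [hτ, div_self hζ0]] at h3
      exact h3.mono_left nhdsWithin_le_nhds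
    have h3 := h2.comp_tendsto hτt
    have h4 : (fun z => τ z - θ) =O[𝓝[sphere 0 1] ζ] fun z => z - ζ := by
      refine Asymptotics.IsBigO.of_bound (Real.pi / 2) ?_
      filter_upwards [self_mem_nhdsWithin] with z hz
      have hz1 : ‖z‖ = 1 := by simpa using hz
      have h5 := angle_le_mul_norm_sub hz1 hζ
      rw [angle_eq_abs_arg (by rw [← norm_ne_zero_iff, hz1]; norm_num) hζ0] at h5
      simpa [hτ] using h5
    refine (h3.trans_isBigO h4).congr' ?_ EventuallyEq.rfl
    filter_upwards [self_mem_nhdsWithin] with z hz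
    have hz1 : ‖z‖ = 1 := by simpa using hz
    have h6 := norm_mul_exp_arg_mul_I (z / ζ)
    rw [norm_div, hz1, hζ, div_one, ofReal_one, one_mul] at h6
    simp only [Function.comp_apply, hcm, hτ]
    push_cast
    rw [add_mul, exp_add, h6, ← hζdef, mul_div_cancel₀ _ hζ0]
  have hlim := tendsto_deriv_radial_zero hdc hM hζ ho
  have hlim2 := hlim.add_const c
  rw [zero_add] at hlim2
  refine hlim2.congr' ?_
  filter_upwards [Ioo_mem_nhdsLT (show (0 : ℝ) < 1 by norm_num)] with r hr
  rw [(hhd _ _).deriv, sub_add_cancel]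
  rw [mem_ball_zero_iff, norm_mul, hζ, mul_one, norm_real, Real.norm_of_nonneg hr.1.le]
  exact hr.2

/-! ### Parseval's identity and inner functions. -/

theorem norm_sq_toLp_eq_integral (f : C(UnitAddCircle, ℂ)) :
    ‖ContinuousMap.toLp (E := ℂ) 2 (AddCircle.haarAddCircle (T := (1 : ℝ))) ℂ f‖ ^ 2
      = ∫ t : UnitAddCircle, ‖f t‖ ^ 2 ∂AddCircle.haarAddCircle := by
    rw [← inner_self_eq_norm_sq (𝕜 := ℂ), L2.inner_def, ← integral_re (L2.integrable_inner _ _)]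
    refine integral_congr_ae ?_
    filter_upwards [ContinuousMap.coeFn_toLp (p := 2) (𝕜 := ℂ)
      (AddCircle.haarAddCircle (T := (1 : ℝ))) f] with t ht
    rw [ht, inner_self_eq_norm_sq]

/-- **Parseval's identity** on a circle of radius less than one. -/
theorem hasSum_sq_integral {a : SqSum} {φ : ℂ → ℂ}
    (ha : ∀ z : ℂ, ‖z‖ < 1 → HasSum (fun n => a n * z ^ n) (φ z)) {r : ℝ} (hr0 : 0 ≤ r)
    (hr1 : r < 1) :
    HasSum (fun n => ‖a n * (r : ℂ) ^ n‖ ^ 2)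
      ((2 * Real.pi)⁻¹ * ∫ θ in (-Real.pi)..Real.pi, ‖φ (r * exp (θ * I))‖ ^ 2) := by
  have hrn : ‖(r : ℂ)‖ < 1 := by simpa [abs_of_nonneg hr0] using hr1
  have sc := summable_coeff_mul_pow a hrn
  have H := norm_sq_toLp_tsum_fourier sc
  convert H using 1
  set f : C(UnitAddCircle, ℂ) := ∑' n : ℕ, (a n * (r : ℂ) ^ n) • (fourier (n : ℤ)) with hf
  have hval : ∀ t : UnitAddCircle, f t = φ (r * fourier 1 t) := by
    intro t
    have hs : Summable fun n : ℕ =>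
        (a n * (r : ℂ) ^ n) • (fourier (n : ℤ) : C(UnitAddCircle, ℂ)) := by
      refine Summable.of_norm ?_
      simpa [norm_smul, fourier_norm] using sc
    have hz : ‖(r : ℂ) * fourier 1 t‖ < 1 := by
      have : ‖(fourier 1 t : ℂ)‖ = 1 := by
        rw [fourier_one]
        exact Circle.norm_coe _
      rw [norm_mul, this, mul_one]; exact hrn
    rw [hf, ← ContinuousMap.tsum_apply hs, ← (ha _ hz).tsum_eq]
    refine tsum_congr fun n => ?_
    have : (fourier (n : ℤ) t : ℂ) = (fourier 1 t) ^ n := by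
      simp [fourier_apply, AddCircle.toCircle_nsmul]
    simp only [ContinuousMap.smul_apply, smul_eq_mul, this]
    ring
  have h2 : (AddCircle.haarAddCircle (T := (1 : ℝ))) = volume := by
    rw [AddCircle.volume_eq_smul_haarAddCircle]; simp
  rw [norm_sq_toLp_eq_integral, h2, ← UnitAddCircle.intervalIntegral_preimage (-1 / 2)]
  have h4 := intervalIntegral.integral_comp_mul_left
    (f := fun θ : ℝ => ‖φ (r * exp (θ * I))‖ ^ 2) (a := -1 / 2) (b := -1 / 2 + 1)
    (c := 2 * Real.pi) (by positivity)
  rw [show 2 * Real.pi * (-1 / 2) = -Real.pi by ring,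
    show 2 * Real.pi * (-1 / 2 + 1) = Real.pi by ring, smul_eq_mul] at h4
  rw [← h4]
  refine intervalIntegral.integral_congr fun t _ => ?_
  simp only [hval]
  congr 4
  rw [fourier_coe_apply]
  congr 1
  push_cast
  ring

/-- A function in the unit ball of `H^∞` with norm one in `H²` is inner. -/
theorem HInfty.isInner_of_norm_eq_one {φ : HInfty} (hφ : ∀ z ∈ ball (0 : ℂ) 1, ‖φ z‖ ≤ 1)
    {a : SqSum} (ha : ∀ z : ℂ, ‖z‖ < 1 → HasSum (fun n => a n * z ^ n) (φ z)) (ha1 : ‖a‖ = 1) :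
    φ.IsInner := by
  set μ := volume.restrict (Set.Ioc (-Real.pi) Real.pi) with hμ
  have hlim : ∀ᵐ θ : ℝ ∂μ, ∃ c : ℂ, Tendsto (fun r : ℝ => φ (r * exp (θ * I))) (𝓝[<] 1) (𝓝 c) :=
    ae_restrict_of_ae φ.ae_exists_radial_limit
  -- Where no radial limit exists the value is arbitrary; this happens only on a null set.
  set b : ℝ → ℂ := fun θ => limUnder (𝓝[<] 1) fun r : ℝ => φ (r * exp (θ * I)) with hb
  have hlim' : ∀ᵐ θ : ℝ ∂μ, Tendsto (fun r : ℝ => φ (r * exp (θ * I))) (𝓝[<] 1) (𝓝 (b θ)) :=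
    hlim.mono fun θ h => tendsto_nhds_limUnder h
  set ρ : ℕ → ℝ := fun k => 1 - 1 / ((k : ℝ) + 1 + 1) with hρ
  have hρ0 : ∀ k, 0 ≤ ρ k := fun k => by
    have : 1 / ((k : ℝ) + 1 + 1) ≤ 1 := by
      rw [div_le_one (by positivity)]; linarith [(Nat.cast_nonneg k : (0 : ℝ) ≤ k)]
    simp only [hρ]; linarith
  have hρ1 : ∀ k, ρ k < 1 := fun k => by
    have : 0 < 1 / ((k : ℝ) + 1 + 1) := by positivity
    simp only [hρ]; linarith
  have hρt : Tendsto ρ atTop (𝓝[<] 1) := by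
    refine tendsto_nhdsWithin_iff.mpr ⟨?_, Eventually.of_forall hρ1⟩
    have h1 := (tendsto_one_div_add_atTop_nhds_zero_nat (𝕜 := ℝ)).comp (tendsto_add_atTop_nat 1)
    have h2 := h1.const_sub 1
    simpa [hρ, Function.comp_def] using h2
  have hmem : ∀ k (θ : ℝ), (ρ k : ℂ) * exp (θ * I) ∈ ball (0 : ℂ) 1 := fun k θ => by
    rw [mem_ball_zero_iff, norm_mul, norm_exp_ofReal_mul_I, mul_one, norm_real,
      Real.norm_of_nonneg (hρ0 k)]
    exact hρ1 k
  have hmeas : ∀ k, AEStronglyMeasurable (fun θ : ℝ => ‖φ (ρ k * exp (θ * I))‖ ^ 2) μ := fun k => by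
    have : Continuous fun θ : ℝ => φ (ρ k * exp (θ * I)) :=
      φ.holomorphic.continuousOn.comp_continuous (by fun_prop) (hmem k)
    exact (this.norm.pow 2).aestronglyMeasurable
  have hle : ∀ k (θ : ℝ), ‖φ (ρ k * exp (θ * I))‖ ^ 2 ≤ 1 := fun k θ =>
    pow_le_one₀ (norm_nonneg _) (hφ _ (hmem k θ))
  have htk : ∀ᵐ θ : ℝ ∂μ, Tendsto (fun k => ‖φ (ρ k * exp (θ * I))‖ ^ 2) atTop (𝓝 (‖b θ‖ ^ 2)) :=
    hlim'.mono fun θ h => ((h.comp hρt).norm.pow 2)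
  have hble : ∀ᵐ θ : ℝ ∂μ, ‖b θ‖ ^ 2 ≤ 1 := htk.mono fun θ h => le_of_tendsto' h fun k => hle k θ
  have hbint : Integrable (fun θ => ‖b θ‖ ^ 2) μ := by
    refine Integrable.mono' (g := fun _ => (1 : ℝ)) (integrable_const _)
      (aestronglyMeasurable_of_tendsto_ae atTop hmeas htk) (hble.mono fun θ h => ?_)
    rwa [Real.norm_of_nonneg (by positivity)]
  have hconv : Tendsto (fun k => ∫ θ, ‖φ (ρ k * exp (θ * I))‖ ^ 2 ∂μ) atTop
      (𝓝 (∫ θ, ‖b θ‖ ^ 2 ∂μ)) := by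
    refine tendsto_integral_of_dominated_convergence (fun _ => (1 : ℝ)) hmeas (integrable_const _)
      (fun k => Eventually.of_forall fun θ => ?_) htk
    rw [Real.norm_of_nonneg (by positivity)]
    exact hle k θ
  have hpi : -Real.pi ≤ Real.pi := by linarith [Real.pi_pos]
  -- Parseval at radius `ρ k` bounds each finite coefficient sum by a mean square. Letting `k → ∞`
  -- on both sides and then taking all `s` yields `1 = ‖a‖² ≤` the mean of `‖b‖²`.
  have hlow : ∀ s : Finset ℕ, ∑ n ∈ s, ‖a n‖ ^ 2 ≤ (2 * Real.pi)⁻¹ * ∫ θ, ‖b θ‖ ^ 2 ∂μ := by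
    intro s
    have h1 : Tendsto (fun k => ∑ n ∈ s, ‖a n * (ρ k : ℂ) ^ n‖ ^ 2) atTop
        (𝓝 (∑ n ∈ s, ‖a n‖ ^ 2)) := by
      have : Continuous fun r : ℝ => ∑ n ∈ s, ‖a n * (r : ℂ) ^ n‖ ^ 2 := by fun_prop
      have h2 := ((this.tendsto 1).mono_left nhdsWithin_le_nhds).comp hρt
      simpa [Function.comp_def] using h2
    refine le_of_tendsto_of_tendsto' h1 (hconv.const_mul (2 * Real.pi)⁻¹) fun k => ?_
    have h3 := hasSum_sq_integral ha (hρ0 k) (hρ1 k)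
    rw [intervalIntegral.integral_of_le hpi] at h3
    exact sum_le_hasSum s (fun _ _ => by positivity) h3
  have ha2 : HasSum (fun n => ‖a n‖ ^ 2) 1 := by
    have := lp.hasSum_norm (p := 2) (by norm_num) a
    simpa [ha1] using this
  have hge : 1 ≤ (2 * Real.pi)⁻¹ * ∫ θ, ‖b θ‖ ^ 2 ∂μ := le_of_tendsto' ha2 hlow
  -- A nonnegative integrand with zero integral vanishes almost everywhere, so `‖b‖ = 1` there.
  have hzero : ∫ θ, (1 - ‖b θ‖ ^ 2) ∂μ = 0 := by
    refine le_antisymm ?_ (integral_nonneg_of_ae (hble.mono fun θ h => sub_nonneg.mpr h))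
    rw [integral_sub (integrable_const _) hbint]
    have h1 : ∫ _, (1 : ℝ) ∂μ = 2 * Real.pi := by
      rw [hμ, ← intervalIntegral.integral_of_le hpi]; simp; ring
    rw [h1, sub_nonpos]
    rwa [← div_eq_inv_mul, le_div_iff₀ (by positivity), one_mul] at hge
  have hone := (integral_eq_zero_iff_of_nonneg_ae (hble.mono fun θ h => sub_nonneg.mpr h)
    ((integrable_const _).sub hbint)).mp hzero
  refine ae_arcLength_of_ae ?_
  filter_upwards [hlim', hone] with θ h1 h2
  refine ⟨b θ, ?_, h1⟩
  have h3 : ‖b θ‖ ^ 2 = 1 := by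
    have : 1 - ‖b θ‖ ^ 2 = 0 := h2
    linarith
  exact (pow_eq_one_iff_of_nonneg (norm_nonneg _) two_ne_zero).mp h3


/-! ### The monomial basis of the Hardy space. -/

/-- The function `z ^ n`. -/
def monomial (n : ℕ) : H2 := coeff.symm (lp.single 2 n (1 : ℂ))

theorem coeff_monomial (n : ℕ) : coeff (monomial n) = lp.single 2 n (1 : ℂ) :=
  LinearEquiv.apply_symm_apply _ _

theorem monomial_apply (n : ℕ) (z : UnitDisc) : monomial n z = (z : ℂ) ^ n := by
  have h := (monomial n).hasSum z
  rw [coeff_monomial] at h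
  have h2 := hasSum_single (f := fun m : ℕ => (lp.single 2 n (1 : ℂ) : SqSum) m * (z : ℂ) ^ m) n
    (fun m hm => by simp [lp.single_apply, hm])
  rw [h.unique h2]
  simp [lp.single_apply]

theorem inner_monomial_left (n : ℕ) (f : H2) : inner ℂ (monomial n) f = coeff f n := by
  have : inner ℂ (monomial n) f = inner ℂ (coeff (monomial n)) (coeff f) := rfl
  rw [this, coeff_monomial, lp.inner_single_left]
  simp

theorem orthonormal_monomial : Orthonormal ℂ monomial := by
  rw [orthonormal_iff_ite]
  intro i j
  rw [inner_monomial_left, coeff_monomial, lp.single_apply]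
  simp [Pi.single_apply]

theorem mulOp_z_monomial (n : ℕ) : mulOp HInfty.z (monomial n) = monomial (n + 1) := by
  refine H2.ext fun z => ?_
  rw [mulOp_apply, monomial_apply, monomial_apply, pow_succ']
  rfl

theorem hasSum_monomial (f : H2) : HasSum (fun n => coeff f n • monomial n) f := by
  have h := (lp.hasSum_single (p := 2) (by norm_num) (coeff f)).mapL
    coeffIsometry.symm.toContinuousLinearEquiv.toContinuousLinearMap
  have e : coeffIsometry.symm.toContinuousLinearEquiv.toContinuousLinearMap (coeff f) = f :=
    coeff.symm_apply_apply f
  rw [e] at h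
  refine h.congr_fun fun n => ?_
  have h1 : (lp.single 2 n (coeff f n) : SqSum) = coeff f n • lp.single 2 n (1 : ℂ) := by
    rw [← lp.single_smul]; simp
  change _ = coeff.symm (lp.single 2 n (coeff f n))
  rw [h1, map_smul, monomial]

theorem H2.clm_ext {E : Type*} [NormedAddCommGroup E] [NormedSpace ℂ E] {S T : H2 →L[ℂ] E}
    (h : ∀ n, S (monomial n) = T (monomial n)) : S = T := by
  ext f
  have h1 := (hasSum_monomial f).mapL S
  have h2 := (hasSum_monomial f).mapL T
  simp only [map_smul, h] at h1 h2
  exact h1.unique h2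

theorem norm_sq_sum_smul {ι E : Type*} [NormedAddCommGroup E] [InnerProductSpace ℂ E] {v : ι → E}
    (hv : Orthonormal ℂ v) (c : ι → ℂ) (s : Finset ι) :
    ‖∑ i ∈ s, c i • v i‖ ^ 2 = ∑ i ∈ s, ‖c i‖ ^ 2 := by
  have h := hv.inner_sum c c s
  rw [inner_self_eq_norm_sq_to_K] at h
  have h2 : ∀ i, (starRingEnd ℂ) (c i) * c i = ((‖c i‖ ^ 2 : ℝ) : ℂ) := fun i => by
    rw [mul_comm, Complex.mul_conj, Complex.normSq_eq_norm_sq]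
  simp only [h2, coe_algebraMap] at h
  exact_mod_cast h

/-! ### Operators intertwining a unitary with the shift. -/

section Intertwiner

variable {K : Type*} [NormedAddCommGroup K] [InnerProductSpace ℂ K]

theorem pow_apply_intertwiner {U : K →L[ℂ] K} {B : H2 →L[ℂ] K} (h : U ∘L B = B ∘L mulOp HInfty.z)
    (n : ℕ) : (U ^ n) (B (monomial 0)) = B (monomial n) := by
  induction n with
  | zero => simp
  | succ n ih =>
    rw [pow_succ', mul_apply_eq_comp, ih, ← mulOp_z_monomial]
    exact DFunLike.congr_fun h (monomial n)

variable [CompleteSpace K]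

/-- If `B` intertwines `U` and `M_z`, the functional calculus of `U` at `B 1` is dominated by the
`L²`-norm on the circle. -/
theorem norm_calculus_intertwiner_le {U : K →L[ℂ] K} (hU : U ∈ unitary (K →L[ℂ] K))
    {B : H2 →L[ℂ] K} (h : U ∘L B = B ∘L mulOp HInfty.z)
    {Φ : C(UnitAddCircle, ℂ) →⋆ₐ[ℂ] (K →L[ℂ] K)} (hΦ : Continuous Φ) (hΦ1 : Φ (fourier 1) = U)
    (f : C(UnitAddCircle, ℂ)) :
    ‖Φ f (B (monomial 0))‖
      ≤ ‖B‖ * ‖ContinuousMap.toLp (E := ℂ) 2 (AddCircle.haarAddCircle (T := (1 : ℝ))) ℂ f‖ := by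
  set L := ContinuousMap.toLp (E := ℂ) 2 (AddCircle.haarAddCircle (T := (1 : ℝ))) ℂ with hL
  have hclosed : IsClosed {f : C(UnitAddCircle, ℂ) | ‖Φ f (B (monomial 0))‖ ≤ ‖B‖ * ‖L f‖} := by
    refine isClosed_le ?_ (by fun_prop)
    exact (hΦ.clm_apply continuous_const).norm
  have hmem : f ∈ closure (Submodule.span ℂ (Set.range (fourier (T := (1 : ℝ)))) :
      Set C(UnitAddCircle, ℂ)) := by
    rw [← Submodule.topologicalClosure_coe, span_fourier_closure_eq_top]
    trivial
  refine hclosed.closure_subset_iff.mpr ?_ hmem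
  intro g hg
  obtain ⟨c, rfl⟩ := Finsupp.mem_span_range_iff_exists_finsupp.mp hg
  have hfour : ∀ n : ℕ, Φ (fourier (n : ℤ)) = U ^ n := by
    intro n
    rw [← hΦ1, ← map_pow]
    congr 1
    ext t
    simp [fourier_apply, AddCircle.toCircle_nsmul]
  -- Multiplying by the `N`th power makes every exponent nonnegative, so the polynomial becomes an
  -- element of `H²` on which `B` acts. Since `U ^ N` is isometric and the exponents stay distinct,
  -- both norms are preserved.
  obtain ⟨N, hN⟩ : ∃ N : ℕ, ∀ i ∈ c.support, 0 ≤ (N : ℤ) + i := by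
    refine ⟨c.support.sup Int.natAbs, fun i hi => ?_⟩
    have : i.natAbs ≤ c.support.sup Int.natAbs := Finset.le_sup hi
    omega
  have hnU : ∀ x, ‖(U ^ N) x‖ = ‖x‖ := by
    have hUN : U ^ N ∈ unitary (K →L[ℂ] K) := pow_mem hU N
    exact (ContinuousLinearMap.norm_map_iff_adjoint_comp_self _).mpr (Unitary.star_mul_self_of_mem hUN)
  have hshift : (U ^ N) (Φ (c.sum fun i a => a • fourier i) (B (monomial 0)))
      = B (∑ i ∈ c.support, c i • monomial ((N : ℤ) + i).toNat) := by
    rw [← mul_apply_eq_comp, ← hfour, ← map_mul, Finsupp.sum, Finset.mul_sum, map_sum,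
      map_sum, sum_apply]
    refine Finset.sum_congr rfl fun i hi => ?_
    have e : (fourier (N : ℤ) : C(UnitAddCircle, ℂ)) * c i • fourier i
        = c i • fourier ((((N : ℤ) + i).toNat : ℕ) : ℤ) := by
      rw [Int.toNat_of_nonneg (hN i hi)]
      ext t
      simp only [ContinuousMap.mul_apply, ContinuousMap.smul_apply, smul_eq_mul, fourier_add]
      ring
    rw [e, map_smul, map_smul, smul_apply, hfour, pow_apply_intertwiner h]
  have hnorm : ‖∑ i ∈ c.support, c i • monomial ((N : ℤ) + i).toNat‖
      = ‖L (c.sum fun i a => a • fourier i)‖ := by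
    have h1 : ‖L (c.sum fun i a => a • fourier i)‖ ^ 2 = ∑ i ∈ c.support, ‖c i‖ ^ 2 := by
      rw [← norm_sq_sum_smul (orthonormal_fourier (T := (1 : ℝ))), Finsupp.sum, map_sum]
      simp only [map_smul]
      rfl
    have h2 : ‖∑ i ∈ c.support, c i • monomial ((N : ℤ) + i).toNat‖ ^ 2
        = ∑ i ∈ c.support, ‖c i‖ ^ 2 := by
      rw [← Finset.sum_coe_sort, ← Finset.sum_coe_sort c.support fun i => ‖c i‖ ^ 2]
      refine norm_sq_sum_smul (v := fun i : c.support => monomial ((N : ℤ) + i).toNat)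
        (orthonormal_monomial.comp _ fun i j hij => ?_) (fun i : c.support => c i) Finset.univ
      have hi := hN i i.2
      have hj := hN j j.2
      exact Subtype.ext (by omega)
    rw [← h2] at h1
    exact ((pow_left_inj₀ (norm_nonneg _) (norm_nonneg _) two_ne_zero).mp h1).symm
  change ‖Φ _ (B (monomial 0))‖ ≤ ‖B‖ * ‖L _‖
  rw [← hnU, hshift, ← hnorm]
  exact B.le_opNorm _

/-- Passes from angles in `(-π, π]` to the circle of circumference one. Rescaling by `2π` preserves
null sets. -/
theorem volume_preimage_toCircle_eq_zero {σ : Set ℂ} (hσc : IsClosed σ) (hσ : arcLength σ = 0) :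
    volume {t : UnitAddCircle | (AddCircle.toCircle t : ℂ) ∈ σ} = 0 := by
  have hcl : IsClosed {t : UnitAddCircle | (AddCircle.toCircle t : ℂ) ∈ σ} :=
    hσc.preimage (by
      exact continuous_subtype_val.comp AddCircle.continuous_toCircle)
  rw [← (UnitAddCircle.measurePreserving_mk (-1 / 2)).measure_preimage
    hcl.measurableSet.nullMeasurableSet]
  rw [arcLength, Measure.map_apply measurable_exp_ofReal_mul_I hσc.measurableSet,
    Measure.restrict_apply (measurable_exp_ofReal_mul_I hσc.measurableSet)] at hσ
  have h1 := Real.volume_preimage_mul_left (a := 2 * Real.pi) (by positivity)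
    (((fun θ : ℝ => exp (θ * I)) ⁻¹' σ) ∩ Set.Ioc (-Real.pi) Real.pi)
  rw [hσ, mul_zero] at h1
  rw [Measure.restrict_apply ((AddCircle.measurable_mk' (a := (1 : ℝ))) hcl.measurableSet)]
  refine measure_mono_null ?_ h1
  rintro x ⟨hx, hx1, hx2⟩
  have hpi := Real.pi_pos
  refine ⟨?_, by nlinarith, by nlinarith⟩
  have hx' : ((AddCircle.toCircle (x : UnitAddCircle)) : ℂ) ∈ σ := hx
  rw [AddCircle.toCircle_apply_mk, Circle.coe_exp] at hx'
  simpa using hx'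

/-- A unitary operator whose spectrum has arc-length measure zero admits no nonzero operator
intertwining it with the unilateral shift. -/
theorem intertwiner_eq_zero {U : K →L[ℂ] K} (hU : U ∈ unitary (K →L[ℂ] K))
    (hσ : arcLength (spectrum ℂ U) = 0) {B : H2 →L[ℂ] K} (h : U ∘L B = B ∘L mulOp HInfty.z) :
    B = 0 := by
  have hcirc := spectrum.subset_circle_of_unitary (𝕜 := ℂ) hU
  have hn : IsStarNormal U := ⟨by
    rw [commute_iff_eq, Unitary.star_mul_self_of_mem hU, Unitary.mul_star_self_of_mem hU]⟩
  -- The spectrum is mapped into the additive circle so that Fourier monomials can be fed into the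
  -- functional calculus of `U`.
  let ι : C(spectrum ℂ U, UnitAddCircle) :=
    ⟨fun x => (AddCircle.homeomorphCircle one_ne_zero).symm
      ⟨x, mem_sphere_zero_iff_norm.mpr (mem_sphere_zero_iff_norm.mp (hcirc x.2))⟩,
      (AddCircle.homeomorphCircle one_ne_zero).symm.continuous.comp (by fun_prop)⟩
  have hι : ∀ x, (AddCircle.toCircle (ι x) : ℂ) = x := fun x => by
    rw [← AddCircle.homeomorphCircle_apply one_ne_zero]
    exact congrArg Subtype.val ((AddCircle.homeomorphCircle one_ne_zero).apply_symm_apply _)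
  let Φ : C(UnitAddCircle, ℂ) →⋆ₐ[ℂ] (K →L[ℂ] K) :=
    (cfcHom hn).comp (ContinuousMap.compStarAlgHom' ℂ ℂ ι)
  have hΦa : ∀ f, Φ f = cfcHom hn (f.comp ι) := fun _ => rfl
  have hΦ : Continuous Φ := by
    exact (cfcHom_continuous hn).comp (ContinuousMap.continuous_precomp ι)
  have hΦ1 : Φ (fourier 1) = U := by
    rw [hΦa]
    conv_rhs => rw [← cfcHom_id (R := ℂ) hn]
    congr 1
    ext x
    simpa [fourier_apply] using hι x
  set b := B (monomial 0) with hb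
  have hb0 : b = 0 := by
    set E := {t : UnitAddCircle | (AddCircle.toCircle t : ℂ) ∈ spectrum ℂ U} with hE
    have hEc : IsClosed E := (spectrum.isClosed U).preimage (by
      exact continuous_subtype_val.comp AddCircle.continuous_toCircle)
    have hE0 : volume E = 0 := volume_preimage_toCircle_eq_zero (spectrum.isClosed U) hσ
    have key : ∀ ε : ℝ, 0 < ε → ‖b‖ ^ 2 ≤ ‖B‖ ^ 2 * ε := by
      intro ε hε
      -- Outer regularity followed by Urysohn's lemma: `u` is one on the spectrum, so the calculus
      -- sends it to the identity, while its squared `L²`-norm is at most the measure of `V`.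
      obtain ⟨V, hEV, hVo, hV⟩ := Set.exists_isOpen_lt_of_lt (μ := volume) E (ENNReal.ofReal ε)
        (by rw [hE0]; exact ENNReal.ofReal_pos.mpr hε)
      obtain ⟨u, hu0, hu1, hu⟩ := exists_continuous_zero_one_of_isClosed hVo.isClosed_compl hEc
        (Set.disjoint_compl_left_iff_subset.mpr hEV)
      let f : C(UnitAddCircle, ℂ) := ⟨fun t => (u t : ℂ), by fun_prop⟩
      have hf1 : Φ f = 1 := by
        rw [hΦa, ← map_one (cfcHom hn (R := ℂ))]
        congr 1
        ext x
        have : u (ι x) = 1 := hu1 (by rw [hE, Set.mem_ofPred_eq, hι]; exact x.2)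
        simp [f, this]
      have h1 := norm_calculus_intertwiner_le hU h hΦ hΦ1 f
      rw [hf1, one_apply_eq_self] at h1
      have h2 := pow_le_pow_left₀ (norm_nonneg _) h1 2
      rw [mul_pow, norm_sq_toLp_eq_integral] at h2
      refine h2.trans ?_
      gcongr
      have hvol : (AddCircle.haarAddCircle (T := (1 : ℝ))) = volume := by
        rw [AddCircle.volume_eq_smul_haarAddCircle]; simp
      rw [hvol]
      calc ∫ t, ‖f t‖ ^ 2 ≤ ∫ t, V.indicator (fun _ => (1 : ℝ)) t := by
            refine integral_mono_of_nonneg (Eventually.of_forall fun t => by positivity)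
              ((integrable_const _).indicator hVo.measurableSet) (Eventually.of_forall fun t => ?_)
            by_cases ht : t ∈ V
            · simp only [Set.indicator_of_mem ht]
              have := hu t
              have h3 : ‖f t‖ = u t := by simp [f, abs_of_nonneg this.1]
              rw [h3]
              exact pow_le_one₀ this.1 this.2
            · have h3 : u t = 0 := hu0 ht
              simp [f, h3, Set.indicator_of_notMem ht]
        _ = volume.real V := by
            rw [integral_indicator_const _ hVo.measurableSet]; simp
        _ ≤ ε := ENNReal.toReal_le_of_le_ofReal hε.le hV.le
    have hle : ‖b‖ ^ 2 ≤ 0 := by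
      have hlim : Tendsto (fun ε : ℝ => ‖B‖ ^ 2 * ε) (𝓝[>] 0) (𝓝 0) := by
        have : Continuous fun ε : ℝ => ‖B‖ ^ 2 * ε := by fun_prop
        simpa using (this.tendsto 0).mono_left nhdsWithin_le_nhds
      exact ge_of_tendsto hlim (by filter_upwards [self_mem_nhdsWithin] with ε hε using key ε hε)
    exact norm_eq_zero.mp (pow_eq_zero_iff two_ne_zero |>.mp (le_antisymm hle (by positivity)))
  refine H2.clm_ext fun n => ?_
  rw [← pow_apply_intertwiner h, ← hb, hb0]
  simp

end Intertwiner

/-! ### The commutant of the shift -/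

theorem H2.norm_apply_le (f : H2) (z : UnitDisc) :
    ‖f z‖ ≤ ‖f‖ * ∑' n : ℕ, ‖(z : ℂ)‖ ^ n := by
  have hs := (summable_geometric_of_lt_one (norm_nonneg (z : ℂ)) z.norm_lt_one).mul_left ‖f‖
  rw [← (f.hasSum z).tsum_eq, ← tsum_mul_left]
  refine tsum_of_norm_bounded hs.hasSum fun n => ?_
  rw [norm_mul, norm_pow]
  gcongr
  exact lp.norm_apply_le_norm (by norm_num) (coeff f) n

/-- Evaluation at a point of the disc. -/
def evalCLM (z : UnitDisc) : H2 →L[ℂ] ℂ :=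
  LinearMap.mkContinuousOfExistsBound
    { toFun := fun f => f z
      map_add' := fun f g => H2.coe_add f g z
      map_smul' := fun c f => H2.coe_smul c f z }
    ⟨∑' n : ℕ, ‖(z : ℂ)‖ ^ n, fun f => by rw [mul_comm]; exact H2.norm_apply_le f z⟩

theorem evalCLM_apply (z : UnitDisc) (f : H2) : evalCLM z f = f z := rfl

/-- The contractions commuting with the shift are the multiplications by functions in the unit
ball of `H^∞`. -/
theorem exists_eq_mulOp_of_commute {D : H2 →L[ℂ] H2} (hD : ‖D‖ ≤ 1)
    (h : D ∘L mulOp HInfty.z = mulOp HInfty.z ∘L D) :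
    ∃ φ : HInfty, (∀ z ∈ ball (0 : ℂ) 1, ‖φ z‖ ≤ 1) ∧ D = mulOp φ := by
  have hmon : ∀ (n : ℕ) (z : UnitDisc), D (monomial n) z = (z : ℂ) ^ n * D (monomial 0) z := by
    intro n z
    induction n with
    | zero => simp
    | succ n ih =>
      rw [← mulOp_z_monomial]
      have := DFunLike.congr_fun h (monomial n)
      simp only [ContinuousLinearMap.comp_apply] at this
      rw [this, mulOp_apply, ih, pow_succ', mul_assoc]
      rfl
  have hev : ∀ (z : UnitDisc) (f : H2), D f z = D (monomial 0) z * f z := by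
    intro z f
    -- Evaluation at `z` is an eigenvector of the transpose of `D`, with eigenvalue `(D 1)(z)`. As
    -- `D` is a contraction and evaluation is nonzero, that eigenvalue has modulus at most one.
    have : evalCLM z ∘L D = D (monomial 0) z • evalCLM z := H2.clm_ext fun n => by
      simp only [ContinuousLinearMap.comp_apply, smul_apply, evalCLM_apply,
        hmon n, monomial_apply, smul_eq_mul]
      ring
    exact DFunLike.congr_fun this f
  have hbd : ∀ z : UnitDisc, ‖D (monomial 0) z‖ ≤ 1 := by
    intro z
    set M := ‖evalCLM z‖
    set c := D (monomial 0) z with hc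
    have hM : ∀ f : H2, ‖f z‖ ≤ M * ‖f‖ := (evalCLM z).le_opNorm
    have hpos : 0 < M := by
      have := hM (monomial 0)
      rw [monomial_apply, orthonormal_monomial.1 0] at this
      simp only [pow_zero, norm_one, mul_one] at this
      linarith
    by_contra! hc1
    have hc0 : 0 < ‖c‖ := zero_lt_one.trans hc1
    have hle : M ≤ M / ‖c‖ := by
      refine ContinuousLinearMap.opNorm_le_bound _ (by positivity) fun f => ?_
      rw [div_mul_eq_mul_div, le_div_iff₀ hc0, mul_comm, ← norm_mul]
      change ‖c * f z‖ ≤ _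
      rw [← hev]
      refine (hM _).trans ?_
      gcongr
      exact (D.le_opNorm f).trans (mul_le_of_le_one_left (norm_nonneg f) hD)
    rw [le_div_iff₀ hc0] at hle
    nlinarith
  set g : ℂ → ℂ := fun z => ∑' n : ℕ, coeff (D (monomial 0)) n * z ^ n
  have hg : ∀ z : UnitDisc, g z = D (monomial 0) z := fun z => ((D (monomial 0)).hasSum z).tsum_eq
  have hgs : ∀ z : ℂ, ‖z‖ < 1 → HasSum (fun n => coeff (D (monomial 0)) n * z ^ n) (g z) :=
    fun z hz => (summable_coeff_mul_pow _ hz).of_norm.hasSum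
  have hgb : ∀ z ∈ ball (0 : ℂ) 1, ‖g z‖ ≤ 1 := fun z hz => by
    have := hbd (UnitDisc.mk z (mem_ball_zero_iff.mp hz))
    rw [← hg] at this
    exact this
  have hgd : DifferentiableOn ℂ g (ball 0 1) := by
    have := (hasFPowerSeriesOnBall_of_hasSum hgs).differentiableOn
    have h1 : Metric.eball (0 : ℂ) 1 = Metric.ball 0 1 := by
      simpa using Metric.eball_ofReal (x := (0 : ℂ)) (ε := 1)
    rwa [h1] at this
  refine ⟨⟨g, hgd, 1, hgb⟩, hgb, ?_⟩
  ext f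
  refine H2.ext fun z => ?_
  rw [mulOp_apply, hev]
  exact congrArg (· * f z) (hg z).symm

/-- If `M_φ` is an isometry, then `φ` is inner. -/
theorem HInfty.isInner_of_isometry {φ : HInfty} (hφ : ∀ z ∈ ball (0 : ℂ) 1, ‖φ z‖ ≤ 1)
    (h : ∀ f, ‖mulOp φ f‖ = ‖f‖) : φ.IsInner := by
  refine φ.isInner_of_norm_eq_one hφ (a := coeff (mulOp φ (monomial 0))) (fun z hz => ?_) ?_
  · have h1 := (mulOp φ (monomial 0)).hasSum (UnitDisc.mk z hz)
    rw [mulOp_apply, monomial_apply, pow_zero, mul_one] at h1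
    exact h1
  · rw [← H2.norm_eq, h]
    exact orthonormal_monomial.1 0

end Hardy

namespace BiIsometry

open ContinuousLinearMap

/-! ### Block upper triangular operators. -/

section Block

theorem toLp_eq_iff {K L : Type*} {k k' : K} {f f' : L} :
    WithLp.toLp 2 (k, f) = WithLp.toLp 2 (k', f') ↔ k = k' ∧ f = f' := by
  rw [(WithLp.toLp_injective 2).eq_iff, Prod.mk.injEq]

variable {K L : Type*} [NormedAddCommGroup K] [InnerProductSpace ℂ K]
  [NormedAddCommGroup L] [InnerProductSpace ℂ L]

theorem blockUpper_toLp (A : K →L[ℂ] K) (B : L →L[ℂ] K) (D : L →L[ℂ] L) (k : K) (f : L) :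
    blockUpper A B D (WithLp.toLp 2 (k, f)) = WithLp.toLp 2 (A k + B f, D f) := rfl

theorem commute_of_blockUpper {U A : K →L[ℂ] K} {B : L →L[ℂ] K} {Z D : L →L[ℂ] L}
    (h : ∀ x, blockUpper U 0 Z (blockUpper A B D x) = blockUpper A B D (blockUpper U 0 Z x)) :
    U ∘L A = A ∘L U ∧ U ∘L B = B ∘L Z ∧ D ∘L Z = Z ∘L D := by
  have h' : ∀ k f, U (A k + B f) = A (U k) + B (Z f) ∧ Z (D f) = D (Z f) := fun k f => by
    have := h (WithLp.toLp 2 (k, f))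
    simpa only [blockUpper_toLp, toLp_eq_iff, zero_apply, add_zero] using this
  refine ⟨ext fun k => ?_, ext fun f => ?_, ext fun f => (h' 0 f).2.symm⟩
  · simpa using (h' k 0).1
  · simpa using (h' 0 f).1

variable [CompleteSpace K] [CompleteSpace L]

/-- Preserving norms means preserving inner products. Testing on vectors supported in a single
summand isolates the entries of `V*V = I`. -/
theorem isometry_of_blockUpper {A : K →L[ℂ] K} {B : L →L[ℂ] K} {D : L →L[ℂ] L}
    (h : ∀ x, ‖blockUpper A B D x‖ = ‖x‖) :
    adjoint A ∘L A = .id ℂ K ∧ adjoint A ∘L B = 0 ∧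
      adjoint B ∘L B + adjoint D ∘L D = .id ℂ L := by
  let V : WithLp 2 (K × L) →ₗᵢ[ℂ] WithLp 2 (K × L) := ⟨(blockUpper A B D).toLinearMap, h⟩
  have h' : ∀ k f k' f', inner ℂ (A k + B f) (A k' + B f') + inner ℂ (D f) (D f')
      = inner ℂ k k' + inner ℂ f f' := fun k f k' f' =>
    V.inner_map_map (WithLp.toLp 2 (k, f)) (WithLp.toLp 2 (k', f'))
  refine ⟨ext fun k => ext_inner_left ℂ fun k' => ?_, ext fun f => ext_inner_left ℂ fun k' => ?_,
    ext fun f => ext_inner_left ℂ fun f' => ?_⟩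
  · simpa [adjoint_inner_right] using h' k' 0 k 0
  · simpa [adjoint_inner_right] using h' k' 0 0 f
  · simpa [adjoint_inner_right, inner_add_right] using h' 0 f' 0 f

end Block

/-! ### The Wold decomposition. -/

section Isometry

variable {H : Type*} [NormedAddCommGroup H] [InnerProductSpace ℂ H] [CompleteSpace H]
  {T : H →L[ℂ] H}

theorem norm_apply_of_isometry (hT : adjoint T ∘L T = .id ℂ H) (x : H) : ‖T x‖ = ‖x‖ :=
  (norm_map_iff_adjoint_comp_self T).mpr hT x

theorem adjoint_apply_apply (hT : adjoint T ∘L T = .id ℂ H) (x : H) : adjoint T (T x) = x :=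
  DFunLike.congr_fun hT x

theorem adjoint_mem_hyperRange (hT : adjoint T ∘L T = .id ℂ H) {x : H} (hx : x ∈ hyperRange T) :
    adjoint T x ∈ hyperRange T := by
  rw [mem_hyperRange] at hx ⊢
  intro n
  obtain ⟨y, rfl⟩ := hx (n + 1)
  exact ⟨y, by rw [pow_succ', mul_apply_eq_comp, adjoint_apply_apply hT]⟩

theorem apply_adjoint_of_mem_hyperRange (hT : adjoint T ∘L T = .id ℂ H) {x : H}
    (hx : x ∈ hyperRange T) : T (adjoint T x) = x := by
  obtain ⟨y, rfl⟩ := mem_hyperRange.mp hx 1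
  rw [pow_one, adjoint_apply_apply hT]

/-- The adjoint of `T` maps the hyper-range into itself and is a right inverse of `T` there, so the
restricted isometry is onto. -/
theorem hyperRangePart_mem_unitary (hT : adjoint T ∘L T = .id ℂ H) [CompleteSpace (hyperRange T)] :
    hyperRangePart T ∈ unitary (hyperRange T →L[ℂ] hyperRange T) := by
  have h1 : adjoint (hyperRangePart T) ∘L hyperRangePart T = .id ℂ _ :=
    (norm_map_iff_adjoint_comp_self _).mp fun x => norm_apply_of_isometry hT (x : H)
  refine Unitary.mem_iff.mpr ⟨h1, ext fun x => ?_⟩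
  obtain ⟨y, rfl⟩ : ∃ y, hyperRangePart T y = x :=
    ⟨⟨adjoint T x, adjoint_mem_hyperRange hT x.2⟩,
      Subtype.ext (apply_adjoint_of_mem_hyperRange hT x.2)⟩
  exact congrArg (hyperRangePart T) (DFunLike.congr_fun h1 y)

theorem apply_mem_hyperRange_orthogonal (hT : adjoint T ∘L T = .id ℂ H) {x : H}
    (hx : x ∈ (hyperRange T)ᗮ) : T x ∈ (hyperRange T)ᗮ := by
  rw [Submodule.mem_orthogonal] at hx ⊢
  intro k hk
  rw [← adjoint_inner_left]
  exact hx _ (adjoint_mem_hyperRange hT hk)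

theorem mem_hyperRange_orthogonal_of_adjoint_eq_zero (hT : adjoint T ∘L T = .id ℂ H) {e : H}
    (he : adjoint T e = 0) (n : ℕ) : (T ^ n) e ∈ (hyperRange T)ᗮ := by
  induction n with
  | zero =>
    rw [Submodule.mem_orthogonal]
    intro k hk
    rw [← apply_adjoint_of_mem_hyperRange hT hk, ← adjoint_inner_right, pow_zero,
      one_apply_eq_self, he, inner_zero_right]
  | succ n ih =>
    rw [pow_succ', mul_apply_eq_comp]
    exact apply_mem_hyperRange_orthogonal hT ih

/-- Cancelling the isometry `T ^ i` reduces orthogonality to that of `e` and the range of `T`, which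
is `adjoint T e = 0`. -/
theorem orthonormal_pow_apply (hT : adjoint T ∘L T = .id ℂ H) {e : H} (he : adjoint T e = 0)
    (he1 : ‖e‖ = 1) : Orthonormal ℂ fun n : ℕ => (T ^ n) e := by
  have hn : ∀ n : ℕ, ∀ x, ‖(T ^ n) x‖ = ‖x‖ := by
    intro n
    induction n with
    | zero => simp
    | succ n ih => intro x; rw [pow_succ', mul_apply_eq_comp,
        norm_apply_of_isometry hT, ih]
  have hlt : ∀ i j : ℕ, i < j → inner ℂ ((T ^ i) e) ((T ^ j) e) = 0 := by
    intro i j hij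
    obtain ⟨m, rfl⟩ := Nat.exists_eq_add_of_lt hij
    let V : H →ₗᵢ[ℂ] H := ⟨(T ^ i).toLinearMap, hn i⟩
    rw [add_assoc, pow_add, mul_apply_eq_comp]
    refine (V.inner_map_map e ((T ^ (m + 1)) e)).trans ?_
    rw [pow_succ', mul_apply_eq_comp, ← adjoint_inner_left, he, inner_zero_left]
  refine ⟨fun n => by rw [hn, he1], fun i j hij => ?_⟩
  rcases lt_or_gt_of_ne hij with h | h
  · exact hlt i j h
  · rw [inner_eq_zero_symm]; exact hlt j i h

open Hardy in
/-- **Wold decomposition** of an isometry of multiplicity one. -/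
theorem exists_wold_decomposition (hT : adjoint T ∘L T = .id ℂ H)
    (hE : Module.finrank ℂ (LinearMap.ker (adjoint T : H →ₗ[ℂ] H)) = 1)
    [CompleteSpace (hyperRange T)] :
    ∃ W : H ≃ₗᵢ[ℂ] WithLp 2 (hyperRange T × H2),
      (∀ k : hyperRange T, W k = WithLp.toLp 2 (k, 0)) ∧
      ∀ x, W (T x) = blockUpper (hyperRangePart T) 0 (mulOp HInfty.z) (W x) := by
  obtain ⟨e, he1, he, hspan⟩ : ∃ e : H, ‖e‖ = 1 ∧ adjoint T e = 0 ∧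
      ∀ y, adjoint T y = 0 → ∃ c : ℂ, y = c • e := by
    obtain ⟨v, hv0, hv⟩ := finrank_eq_one_iff'.mp hE
    have hvn : ((‖(v : H)‖ : ℝ) : ℂ) ≠ 0 := by
      simpa using hv0
    refine ⟨((‖(v : H)‖ : ℝ) : ℂ)⁻¹ • (v : H), norm_smul_inv_norm (by simpa using hv0), ?_,
      fun y hy => ?_⟩
    · rw [map_smul, show adjoint T v = 0 from v.2, smul_zero]
    · obtain ⟨c, hc⟩ := hv ⟨y, hy⟩
      refine ⟨c * ((‖(v : H)‖ : ℝ) : ℂ), ?_⟩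
      rw [smul_smul, mul_assoc, mul_inv_cancel₀ hvn, mul_one]
      exact (congrArg Subtype.val hc).symm
  set K := hyperRange T
  let v : ℕ → Kᗮ := fun n => ⟨(T ^ n) e, mem_hyperRange_orthogonal_of_adjoint_eq_zero hT he n⟩
  have hv : Orthonormal ℂ v := by
    have := orthonormal_pow_apply hT he he1
    rw [orthonormal_iff_ite] at this ⊢
    exact this
  -- Completeness of the orbit of `e`: a vector orthogonal to every `Tⁿe` lies in the hyper-range,
  -- so inside the complement it must be zero.
  have hbot : (Submodule.span ℂ (Set.range v))ᗮ = ⊥ := by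
    rw [eq_bot_iff]
    intro x hx
    have hx' : ∀ n, inner ℂ ((T ^ n) e) (x : H) = 0 := fun n =>
      (Submodule.mem_orthogonal _ x).mp hx (v n) (Submodule.subset_span ⟨n, rfl⟩)
    have hxK : (x : H) ∈ K := by
      rw [mem_hyperRange]
      have key : ∀ n : ℕ, ∃ y, (T ^ n) y = x ∧ ∀ m, inner ℂ ((T ^ m) e) y = 0 := by
        intro n
        induction n with
        | zero => exact ⟨x, rfl, hx'⟩
        | succ n ih =>
          obtain ⟨y, hy, hye⟩ := ih
          -- The defect `y - TT*y` lies in `ker T* = ℂe` and is orthogonal to `e`, so it vanishes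
          -- and `y = TT*y`. Then `T*y` is again orthogonal to the orbit and the argument repeats.
          obtain ⟨c, hc⟩ := hspan (y - T (adjoint T y)) (by
            rw [map_sub, adjoint_apply_apply hT, sub_self])
          have hc0 : c = 0 := by
            have h1 : inner ℂ e (y - T (adjoint T y)) = 0 := by
              have h2 := hye 0
              rw [pow_zero, one_apply_eq_self] at h2
              rw [inner_sub_right, h2, ← adjoint_inner_left, he, inner_zero_left, sub_zero]
            rw [hc, inner_smul_right, inner_self_eq_norm_sq_to_K, he1] at h1
            simpa using h1
          have hTy : T (adjoint T y) = y := by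
            rw [hc0, zero_smul, sub_eq_zero] at hc
            exact hc.symm
          refine ⟨adjoint T y, ?_, fun m => ?_⟩
          · rw [pow_succ, mul_apply_eq_comp, hTy, hy]
          · rw [adjoint_inner_right]
            have := hye (m + 1)
            rwa [pow_succ', mul_apply_eq_comp] at this
      exact fun n => (key n).imp fun y hy => hy.1
    have : (x : H) = 0 := inner_self_eq_zero.mp ((Submodule.mem_orthogonal _ _).mp x.2 _ hxK)
    simpa using this
  let J : Kᗮ ≃ₗᵢ[ℂ] H2 := (HilbertBasis.mkOfOrthogonalEqBot hv hbot).repr.trans coeffIsometry.symm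
  have hJ : ∀ n, J.symm (monomial n) = v n := fun n => by
    have h1 : coeffIsometry (monomial n) = lp.single 2 n (1 : ℂ) := coeff_monomial n
    change (HilbertBasis.mkOfOrthogonalEqBot hv hbot).repr.symm (coeffIsometry (monomial n)) = v n
    rw [h1, HilbertBasis.repr_symm_single, HilbertBasis.coe_mkOfOrthogonalEqBot]
  have hJT : ∀ f : H2, ((J.symm (mulOp HInfty.z f) : Kᗮ) : H) = T (J.symm f : Kᗮ) := by
    have : Kᗮ.subtypeL ∘L J.symm.toContinuousLinearEquiv.toContinuousLinearMap ∘L mulOp HInfty.z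
        = T ∘L Kᗮ.subtypeL ∘L J.symm.toContinuousLinearEquiv.toContinuousLinearMap := by
      refine H2.clm_ext fun n => ?_
      change ((J.symm (mulOp HInfty.z (monomial n)) : Kᗮ) : H) = T (J.symm (monomial n) : Kᗮ)
      rw [mulOp_z_monomial, hJ, hJ]
      change (T ^ (n + 1)) e = T ((T ^ n) e)
      rw [pow_succ', mul_apply_eq_comp]
    exact fun f => DFunLike.congr_fun this f
  let W : H ≃ₗᵢ[ℂ] WithLp 2 (K × H2) :=
    K.orthogonalDecomposition.trans
      (LinearIsometryEquiv.withLpProdCongr 2 (LinearIsometryEquiv.refl ℂ K) J)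
  have hW : ∀ (k : K) (f : H2), W ((k : H) + (J.symm f : Kᗮ)) = WithLp.toLp 2 (k, f) := by
    intro k f
    rw [← LinearIsometryEquiv.eq_symm_apply]
    change _ = K.orthogonalDecomposition.symm (WithLp.toLp 2 (k, J.symm f))
    rw [Submodule.orthogonalDecomposition_symm_apply]
    rfl
  have hW' : ∀ x, ∃ (k : K) (f : H2), x = (k : H) + (J.symm f : Kᗮ) := fun x =>
    ⟨(W x).fst, (W x).snd, W.injective (hW _ _).symm⟩
  refine ⟨W, fun k => by simpa using hW k 0, fun x => ?_⟩
  obtain ⟨k, f, rfl⟩ := hW' x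
  rw [hW, blockUpper_toLp, map_add, ← hJT]
  have := hW (hyperRangePart T k) (mulOp HInfty.z f)
  rw [zero_apply, add_zero]
  exact this

end Isometry

/-! ### Models of bi-isometries and the vanishing of the off-diagonal entry. -/

section Pair

open Hardy in
-- Without `B`, the relation `B*B + M_φ*M_φ = I` says that `M_φ` is an isometry.
theorem IsModel.isInner_of_offDiagonal_eq_zero
    {H K : Type*} [NormedAddCommGroup H] [InnerProductSpace ℂ H] {S₁ S₂ : H →L[ℂ] H}
    [NormedAddCommGroup K] [InnerProductSpace ℂ K] [CompleteSpace K]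
    {U A : K →L[ℂ] K} {B : H2 →L[ℂ] K} {φ : HInfty}
    (h : IsModel S₁ S₂ U A B φ) (hB : B = 0) : φ.IsInner := by
  refine HInfty.isInner_of_isometry h.norm_le_one ((norm_map_iff_adjoint_comp_self _).mpr ?_)
  have := h.sum_eq
  rwa [hB, comp_zero, zero_add] at this

theorem apply_mem_hyperRange_of_commute {H : Type*} [NormedAddCommGroup H] [InnerProductSpace ℂ H]
    {S₁ S₂ : H →L[ℂ] H} (h : S₁ ∘L S₂ = S₂ ∘L S₁) {x : H}
    (hx : x ∈ hyperRange S₁) : S₂ x ∈ hyperRange S₁ := by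
  rw [mem_hyperRange] at hx ⊢
  intro n
  obtain ⟨y, rfl⟩ := hx n
  have hc : Commute S₁ S₂ := h
  exact ⟨S₂ y, DFunLike.congr_fun (hc.pow_left n).eq y⟩

variable {H : Type*} [NormedAddCommGroup H] [InnerProductSpace ℂ H] [CompleteSpace H]
  {S₁ S₂ : H →L[ℂ] H}

open Hardy in
/-- Every bi-isometry with `ker S₁*` one-dimensional has a model, in which the first summand is
the hyper-range. -/
theorem IsBiIsometry.exists_isModel (hS : IsBiIsometry S₁ S₂)
    (hE : Module.finrank ℂ (LinearMap.ker (adjoint S₁ : H →ₗ[ℂ] H)) = 1)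
    [CompleteSpace (hyperRange S₁)] :
    ∃ (W : H ≃ₗᵢ[ℂ] WithLp 2 (hyperRange S₁ × H2)) (A : hyperRange S₁ →L[ℂ] hyperRange S₁)
      (B : H2 →L[ℂ] hyperRange S₁) (φ : HInfty),
      (∀ k : hyperRange S₁, W k = WithLp.toLp 2 (k, 0)) ∧
      (∀ x, W (S₂ x) = blockUpper A B (mulOp φ) (W x)) ∧
      IsModel S₁ S₂ (hyperRangePart S₁) A B φ := by
  obtain ⟨W, hWk, hW₁⟩ := exists_wold_decomposition hS.isometry_fst hE
  have hinv : ∀ x ∈ hyperRange S₁, S₂ x ∈ hyperRange S₁ := fun x hx =>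
    apply_mem_hyperRange_of_commute hS.commute hx
  let A : hyperRange S₁ →L[ℂ] hyperRange S₁ := S₂.restrict hinv
  -- The second column of `S₂` in Wold coordinates; `B` and `D` are its two components. The first
  -- column is `(A, 0)` because `S₂` preserves the hyper-range.
  let R : H2 →L[ℂ] WithLp 2 (hyperRange S₁ × H2) :=
    W.toContinuousLinearEquiv.toContinuousLinearMap ∘L S₂ ∘L
      W.symm.toContinuousLinearEquiv.toContinuousLinearMap ∘L
        (WithLp.prodContinuousLinearEquiv 2 ℂ _ _).symm.toContinuousLinearMap ∘L .inr ℂ _ _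
  have hR : ∀ f, R f = W (S₂ (W.symm (WithLp.toLp 2 (0, f)))) := fun _ => rfl
  let B : H2 →L[ℂ] hyperRange S₁ := WithLp.fstL 2 ℂ _ _ ∘L R
  let D : H2 →L[ℂ] H2 := WithLp.sndL 2 ℂ _ _ ∘L R
  have hBD : ∀ f, R f = WithLp.toLp 2 (B f, D f) := fun _ => rfl
  have hW₂ : ∀ x, W (S₂ x) = blockUpper A B D (W x) := by
    intro x
    obtain ⟨k, f, hkf⟩ : ∃ k f, W x = WithLp.toLp 2 (k, f) := ⟨_, _, rfl⟩
    have hx : x = (k : H) + W.symm (WithLp.toLp 2 (0, f)) := by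
      apply W.injective
      rw [map_add, hWk, LinearIsometryEquiv.apply_symm_apply, hkf, ← WithLp.toLp_add]
      simp
    rw [hkf, hx, map_add, map_add, ← hR, hBD, blockUpper_toLp]
    rw [show S₂ (k : H) = (A k : H) from rfl, hWk, ← WithLp.toLp_add]
    simp
  have hcomm := commute_of_blockUpper (U := hyperRangePart S₁) (A := A) (B := B)
    (Z := mulOp HInfty.z) (D := D) fun y => by
      obtain ⟨x, rfl⟩ := W.surjective y
      rw [← hW₂, ← hW₁, ← hW₁, ← hW₂]
      exact congrArg W (DFunLike.congr_fun hS.commute x)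
  have hiso := isometry_of_blockUpper (A := A) (B := B) (D := D) fun y => by
    obtain ⟨x, rfl⟩ := W.surjective y
    rw [← hW₂, W.norm_map, W.norm_map, norm_apply_of_isometry hS.isometry_snd]
  have hD : ‖D‖ ≤ 1 := by
    refine opNorm_le_bound _ zero_le_one fun f => ?_
    have h1 : ‖R f‖ = ‖f‖ := by
      rw [hR, W.norm_map, norm_apply_of_isometry hS.isometry_snd, W.symm.norm_map]
      simp
    rw [one_mul, ← h1]
    exact WithLp.norm_snd_le _ (R f)
  obtain ⟨φ, hφ, hDφ⟩ := exists_eq_mulOp_of_commute hD hcomm.2.2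
  rw [hDφ] at hW₂ hiso
  exact ⟨W, A, B, φ, hWk, hW₂, hyperRangePart_mem_unitary hS.isometry_fst, hφ, hiso.1, hcomm.1,
    hcomm.2.1, hiso.2.1, hiso.2.2, W, hW₁, hW₂⟩

open Hardy in
/-- In a model of a bi-isometry, the off-diagonal entry vanishes as soon as the spectrum of `S₁` on
the hyper-range has arc-length measure zero. -/
theorem IsModel.offDiagonal_eq_zero (hT : adjoint S₁ ∘L S₁ = .id ℂ H)
    (hσ : arcLength (spectrum ℂ (hyperRangePart S₁)) = 0)
    {K : Type*} [NormedAddCommGroup K] [InnerProductSpace ℂ K] [CompleteSpace K]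
    [CompleteSpace (hyperRange S₁)] {U A : K →L[ℂ] K} {B : H2 →L[ℂ] K} {φ : HInfty}
    (h : IsModel S₁ S₂ U A B φ) : B = 0 := by
  obtain ⟨W, hW₁, -⟩ := h.equivalent
  -- The unitary `U` of an arbitrary model is compared with `S₁` on the hyper-range, since the
  -- spectral hypothesis concerns the latter. The embedding of the first summand carries `U` to
  -- `S₁`.
  let ι : K →L[ℂ] H := W.symm.toContinuousLinearEquiv.toContinuousLinearMap ∘L
    (WithLp.prodContinuousLinearEquiv 2 ℂ K H2).symm.toContinuousLinearMap ∘L .inl ℂ _ _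
  have hι : ∀ k, W (ι k) = WithLp.toLp 2 (k, 0) := fun k => W.apply_symm_apply _
  have hιU : ∀ k, S₁ (ι k) = ι (U k) := fun k => by
    apply W.injective
    rw [hW₁, hι, hι, blockUpper_toLp]
    simp
  -- As `U` is unitary, `ιk = S₁ⁿ ι(U*ⁿk)` for every `n`. Only this inclusion is needed: `ιB` then
  -- intertwines the shift with `S₁` on the hyper-range, and `ι` is injective.
  have hmem : ∀ k, ι k ∈ hyperRange S₁ := by
    intro k
    rw [mem_hyperRange]
    intro n
    induction n generalizing k with
    | zero => exact ⟨_, rfl⟩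
    | succ n ih =>
      obtain ⟨y, hy⟩ := ih (adjoint U k)
      refine ⟨y, ?_⟩
      rw [pow_succ', mul_apply_eq_comp, hy, hιU]
      exact congrArg ι (DFunLike.congr_fun (Unitary.mul_star_self_of_mem h.unitary) k)
  let B' : H2 →L[ℂ] hyperRange S₁ := (ι ∘L B).codRestrict _ fun f => hmem (B f)
  have hB' : B' = 0 := by
    refine intertwiner_eq_zero (hyperRangePart_mem_unitary hT) hσ (ext fun f => Subtype.ext ?_)
    change S₁ (ι (B f)) = ι (B (mulOp HInfty.z f))
    rw [hιU]
    exact congrArg ι (DFunLike.congr_fun h.intertwine f)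
  ext f
  have h1 : ι (B f) = 0 := congrArg Subtype.val (DFunLike.congr_fun hB' f)
  have h2 := hι (B f)
  rw [h1, map_zero] at h2
  exact (congrArg WithLp.fst h2).symm

/-- The only input that is not automatic is that `S₂` preserves the complement. On the hyper-range
the adjoint of `S₁` is its inverse, which commutes with whatever commutes with `S₁`. -/
theorem reducesToDoublyCommutingBiIsometry_hyperRange (hS : IsBiIsometry S₁ S₂)
    [CompleteSpace (hyperRange S₁)]
    (h : ∀ x ∈ (hyperRange S₁)ᗮ, S₂ x ∈ (hyperRange S₁)ᗮ) :
    ReducesToDoublyCommutingBiIsometry (hyperRange S₁) S₁ S₂ := by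
  have hcl : IsClosed (hyperRange S₁ : Set H) :=
    (completeSpace_coe_iff_isComplete.mp inferInstance).isClosed
  have h₁ : Reduces (hyperRange S₁) S₁ :=
    ⟨hcl, apply_mem_hyperRange S₁, fun x hx => apply_mem_hyperRange_orthogonal hS.isometry_fst hx⟩
  have h₂ : Reduces (hyperRange S₁) S₂ :=
    ⟨hcl, fun x hx => apply_mem_hyperRange_of_commute hS.commute hx, h⟩
  have hc : S₁.restrict h₁.invariant ∘L S₂.restrict h₂.invariant
      = S₂.restrict h₂.invariant ∘L S₁.restrict h₁.invariant :=
    ext fun x => Subtype.ext (DFunLike.congr_fun hS.commute (x : H))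
  have hu := hyperRangePart_mem_unitary hS.isometry_fst
  refine ⟨h₁, h₂, ⟨hc, Unitary.star_mul_self_of_mem hu,
    (norm_map_iff_adjoint_comp_self _).mp fun x => norm_apply_of_isometry hS.isometry_snd (x : H)⟩,
    hc, ?_⟩
  set T₁ := S₁.restrict h₁.invariant with hT₁
  set T₂ := S₂.restrict h₂.invariant
  have e1 : star T₁ * T₁ = 1 := Unitary.star_mul_self_of_mem hu
  have e2 : T₁ * star T₁ = 1 := Unitary.mul_star_self_of_mem hu
  have hc' : T₁ * T₂ = T₂ * T₁ := hc
  change star T₁ * T₂ = T₂ * star T₁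
  calc star T₁ * T₂ = star T₁ * (T₂ * T₁) * star T₁ := by
        rw [mul_assoc, mul_assoc, e2, mul_one]
    _ = T₂ * star T₁ := by rw [← hc', ← mul_assoc, e1, one_mul]

end Pair

end BiIsometry

end

open Hardy BiIsometry in
theorem corollary3p4 {H : Type*} [NormedAddCommGroup H] [InnerProductSpace ℂ H] [CompleteSpace H]
    (S₁ S₂ : H →L[ℂ] H) (hS : IsBiIsometry S₁ S₂)
    (hE : Module.finrank ℂ (LinearMap.ker (ContinuousLinearMap.adjoint S₁ : H →ₗ[ℂ] H)) = 1)
    (hσ : arcLength (spectrum ℂ (hyperRangePart S₁)) = 0) :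
    haveI : CompleteSpace (hyperRange S₁) := hS.completeSpace_hyperRange
    (∃ (A : hyperRange S₁ →L[ℂ] hyperRange S₁) (B : H2 →L[ℂ] hyperRange S₁) (φ : HInfty),
      IsModel S₁ S₂ (hyperRangePart S₁) A B φ) ∧
    (∀ (U A : hyperRange S₁ →L[ℂ] hyperRange S₁) (B : H2 →L[ℂ] hyperRange S₁) (φ : HInfty),
      IsModel S₁ S₂ U A B φ → φ.IsInner ∧ B = 0) ∧
    ReducesToDoublyCommutingBiIsometry (hyperRange S₁) S₁ S₂ := by
  have : CompleteSpace (hyperRange S₁) := hS.completeSpace_hyperRange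
  obtain ⟨W, A, B, φ, hWk, hW₂, hmodel⟩ := hS.exists_isModel hE
  refine ⟨⟨A, B, φ, hmodel⟩, fun U A' B' φ' h => ?_,
    reducesToDoublyCommutingBiIsometry_hyperRange hS fun x hx => ?_⟩
  · have hB := h.offDiagonal_eq_zero hS.isometry_fst hσ
    exact ⟨h.isInner_of_offDiagonal_eq_zero hB, hB⟩
  · have hB := hmodel.offDiagonal_eq_zero hS.isometry_fst hσ
    rw [Submodule.mem_orthogonal] at hx ⊢
    -- Since `W` carries the hyper-range onto the first summand, orthogonality to it means a zero
    -- first component. With `B = 0`, the block form of `S₂` keeps that component zero.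
    have hin : ∀ (k : hyperRange S₁) (y : H), inner ℂ (k : H) y = inner ℂ k (W y).fst :=
      fun k y => by
        rw [← W.inner_map_map, hWk, WithLp.prod_inner_apply]
        simp
    have hfst : (W x).fst = 0 := ext_inner_left ℂ fun k => by
      rw [← hin, hx k k.2, inner_zero_right]
    intro k hk
    rw [hin ⟨k, hk⟩, hW₂, blockUpper_apply, hfst, hB]
    simp
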